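/- **Setting.** Let $\mathcal X,\mathcal Y$ be Polish spaces, $\mu\in\mathscr P(\mathcal X)$ an atomless Borel probability measure, and $(X_i)_{i\ge1}$ i.i.d. $\mathcal X$-valued random variables with law $\mu$ on a probability space $(\Omega,\mathcal F,\mathbb P)$. Let $c:\mathcal X\times\mathcal Y\to[0,+\infty]$, $L:\mathcal Y\to[0,+\infty]$ and $H:\mathcal Y\times\mathcal Y\to[0,+\infty]$ be lower semicontinuous, with $H$ symmetric and $\{L\le r\}$ compact for every real $r>0$. Write $\mathcal L(\nu)=\int L\,d\nu$, $\mathcal H(\nu,\nu')=\int H\,d(\nu\otimes\nu')$, and $$\Phi(x,y,\nu)=c(x,y)+L(y)+2\int_{\mathcal Y}H(y,y')\,d\nu(y').$$ Let $\mathscr P_\mu(\mathcal X\times\mathcal Y)$ be the set of $\gamma\in\mathscr P(\mathcal X\times\mathcal Y)$ with first marginal $\mu$. For such $\gamma$, with second marginal $\nu$, put $\mathcal J(\gamma)=\int c\,d\gamma+\mathcal L(\nu)+\mathcal H(\nu,\nu)$; put $\mathcal J=+\infty$ otherwise. A *Cournot–Nash equilibrium* is a $\gamma\in\mathscr P_\mu(\mathcal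 X\times\mathcal Y)$, with second marginal $\nu$, such that $y\in\operatorname{argmin}_{y'\in\mathcal Y}\Phi(x,y',\nu)$ for $\gamma$-a.e. $(x,y)$. **Open-loop game.** For $N\ge1$, a profile consists of measurable families $(\nu_i^x)_{x\in\mathcal X}\subset\mathscr P(\mathcal Y)$, $i=1,\dots,N$. Player $i$ pays $$\mathbb E\Big[\int c(X_i,y)\,d\nu_i^{X_i}(y)+\mathcal L(\nu_i^{X_i})+\frac2N\sum_{j\ne i}\mathcal H(\nu_i^{X_i},\nu_j^{X_j})\Big],$$ and a profile is an *open-loop Nash equilibrium* if no player can lower their own cost by changing only their own family. A random probability measure $\boldsymbol\gamma$ on $\mathcal X\times\mathcal Y$ is *induced* by the profile if $\boldsymbol\gamma=\frac1N\sum_{i}\delta_{X_i}\otimes\nu_i^{X_i}$ a.s.; in that case $$\mathcal J_{\Omega,N}(\boldsymbol\gamma)=\mathbb E\Big[\int c\,d\boldsymbol\gamma+\frac1N\sum_i\mathcal L(\nu_i^{X_i})+\frac1{N^2}\sum_{i\ne j}\mathcal H(\nu_i^{X_i},\nu_j^{X_j})\Big],$$ and $\mathcal J_{\Omega,N}(\boldsymbol\gamma)=+\infty$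 if $\boldsymbol\gamma$ is induced by no profile. The *narrow topology* of random probability measures on a Polish space $\mathcal Z$ is the weakest one making $\boldsymbol\gamma\mapsto\mathbb E\int f(\omega,z)\,d\boldsymbol\gamma(\omega)(z)$ continuous for every $f:\Omega\times\mathcal Z\to\mathbb R$ such that $f(\omega,\cdot)$ is bounded and continuous for a.e. $\omega$, $f(\cdot,z)$ is measurable for every $z$, and $\sup_z|f(\cdot,z)|$ is integrable. **Approximation condition (A).** For every $n\in\mathbb N$ there are $0<C_n<\infty$ and a measurable family $(\nu_n^y)_{y\in\mathcal Y}\subset\mathscr P(\mathcal Y)$ such that, for all $y,y'\in\mathcal Y$, $x\in\mathcal X$, $\nu\in\mathscr P(\mathcal Y)$ with $\Phi(x,y,\nu)<\infty$, $$\mathcal H(\nu_n^y,\nu_n^{y'})\le C_n(1+L(y)+L(y'))\ \text{ for all }n,\qquad \int\Phi(x,z,\nu)\,d\nu_n^y(z)\xrightarrow[n\to\infty]{}\Phi(x,y,\nu).$$ **Theorem.** Assume $\inf_{\mathscr P_\mu(\mathcal X\times\mathcal Y)}\mathcal J<\infty$. 1. For every $N\ge1$ let $\boldsymbol\gamma_N$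 be a minimizer of $\mathcal J_{\Omega,N}$ over the random probability measures on $\mathcal X\times\mathcal Y$. Then each $\boldsymbol\gamma_N$ is induced by a profile, and every profile inducing it is an open-loop Nash equilibrium. Moreover, there are a subsequence $(\boldsymbol\gamma_{N_k})_k$ and a deterministic $\gamma\in\mathscr P_\mu(\mathcal X\times\mathcal Y)$ such that $\boldsymbol\gamma_{N_k}\to\gamma$ in the narrow topology of random probability measures and, if (A) holds, $\gamma$ is a Cournot–Nash equilibrium. 2. Assume in addition that $H$ is (finite,) continuous and bounded. For every $N\ge1$ let $\boldsymbol\gamma_N$ be induced by an open-loop Nash equilibrium. If $(\boldsymbol\gamma_N)_N$ converges in the narrow topology of random probability measures, then its limit is a.s. equal to a deterministic $\gamma\in\mathscr P_\mu(\mathcal X\times\mathcal Y)$, and $\gamma$ is a Cournot–Nash equilibrium. -/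

import Mathlib

open MeasureTheory ProbabilityTheory Filter Topology
open scoped ENNReal NNReal

noncomputable section

namespace CournotNash

/-! ### Random probability measures and their narrow topology -/

/-- Random probability measures on `Z`, that is, measurable maps from `Ω` to the probability
measures on `Z`. The σ-algebra on `ProbabilityMeasure Z` is generated by the evaluations
`μ ↦ μ B`, `B` measurable; for a Polish space `Z` it is the Borel σ-algebra of the narrow
topology. -/
def RandomPM (Ω Z : Type*) [MeasurableSpace Ω] [MeasurableSpace Z] : Type _ :=
  {γ : Ω → ProbabilityMeasure Z // Measurable γ}

/-- A deterministic probability measure, seen as a random one. -/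
def RandomPM.const (Ω : Type*) {Z : Type*} [MeasurableSpace Ω] [MeasurableSpace Z]
    (γ : ProbabilityMeasure Z) : RandomPM Ω Z :=
  ⟨fun _ => γ, measurable_const⟩

/-- Random bounded continuous functions `f : Ω × Z → ℝ`: almost surely `f ω` is bounded and
continuous, `ω ↦ f ω z` is measurable for every `z`, and the sup norm of `f ω` is integrable. -/
structure IsRandomBCF {Ω Z : Type*} [MeasurableSpace Ω] [TopologicalSpace Z]
    (P : Measure Ω) (f : Ω → Z → ℝ) : Prop where
  ae_boundedContinuous : ∀ᵐ ω ∂P, Continuous (f ω) ∧ ∃ C : ℝ, ∀ z, |f ω z| ≤ C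
  measurable_left : ∀ z, Measurable fun ω => f ω z
  integrable_norm : Integrable (fun ω => ⨆ z, |f ω z|) P

/-- The narrow topology on random probability measures: the weakest topology for which
`γ ↦ 𝔼[∫ f(ω, z) dγ(ω)(z)]` is continuous for every random bounded continuous function `f`. -/
@[reducible] def narrowTopology {Ω : Type*} (Z : Type*) [MeasurableSpace Ω] [MeasurableSpace Z]
    [TopologicalSpace Z] (P : Measure Ω) : TopologicalSpace (RandomPM Ω Z) :=
  ⨅ f : {f : Ω → Z → ℝ // IsRandomBCF P f},
    TopologicalSpace.induced
      (fun γ : RandomPM Ω Z => ∫ ω, ∫ z, f.1 ω z ∂(γ.1 ω : Measure Z) ∂P)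
      inferInstance

/-- Convergence of a sequence in the narrow topology of random probability measures. -/
def NarrowTendsto {Ω Z : Type*} [MeasurableSpace Ω] [MeasurableSpace Z] [TopologicalSpace Z]
    (P : Measure Ω) (γ : ℕ → RandomPM Ω Z) (γ₀ : RandomPM Ω Z) : Prop :=
  Tendsto γ atTop (@nhds _ (narrowTopology Z P) γ₀)

section Costs

variable {𝒳 𝒴 : Type*} [MeasurableSpace 𝒳] [MeasurableSpace 𝒴]

/-- The mean individual energy `𝓛(ν) = ∫ L dν`. -/
def meanL (L : 𝒴 → ℝ≥0∞) (ν : Measure 𝒴) : ℝ≥0∞ := ∫⁻ y, L y ∂ν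

/-- The interaction energy `𝓗(ν, ν') = ∫ H d(ν ⊗ ν')`. -/
def interH (H : 𝒴 × 𝒴 → ℝ≥0∞) (ν ν' : Measure 𝒴) : ℝ≥0∞ := ∫⁻ p, H p ∂(ν.prod ν')

/-! ### The game with a continuum of players -/

/-- The set `𝓟_μ(𝒳 × 𝒴)` of plans with first marginal `μ`. -/
def plans (𝒴 : Type*) [MeasurableSpace 𝒴] (μ : ProbabilityMeasure 𝒳) :
    Set (ProbabilityMeasure (𝒳 × 𝒴)) :=
  {γ | (γ : Measure (𝒳 × 𝒴)).map Prod.fst = μ}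

/-- The energy `𝓙(γ) = ∫ c dγ + 𝓛(ν) + 𝓗(ν, ν)`, where `ν` is the second marginal of `γ`, if
`γ ∈ 𝓟_μ(𝒳 × 𝒴)`, and `+∞` otherwise. -/
def energy (c : 𝒳 × 𝒴 → ℝ≥0∞) (L : 𝒴 → ℝ≥0∞) (H : 𝒴 × 𝒴 → ℝ≥0∞) (μ : ProbabilityMeasure 𝒳)
    (γ : ProbabilityMeasure (𝒳 × 𝒴)) : ℝ≥0∞ :=
  open scoped Classical in
  if γ ∈ plans 𝒴 μ then
    ∫⁻ p, c p ∂(γ : Measure (𝒳 × 𝒴))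
      + meanL L ((γ : Measure (𝒳 × 𝒴)).map Prod.snd)
      + interH H ((γ : Measure (𝒳 × 𝒴)).map Prod.snd) ((γ : Measure (𝒳 × 𝒴)).map Prod.snd)
  else ∞

/-- The individual cost `Φ(x, y, ν) = c(x, y) + L(y) + 2 ∫ H(y, y') dν(y')`. -/
def socialCost (c : 𝒳 × 𝒴 → ℝ≥0∞) (L : 𝒴 → ℝ≥0∞) (H : 𝒴 × 𝒴 → ℝ≥0∞)
    (x : 𝒳) (y : 𝒴) (ν : Measure 𝒴) : ℝ≥0∞ :=
  c (x, y) + L y + 2 * ∫⁻ y', H (y, y') ∂ν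

/-- Cournot–Nash equilibria for a cost `Φ` and a distribution of types `μ`: the first marginal
of `γ` is `μ` and, for `γ`-a.e. `(x, y)`, the strategy `y` minimizes `Φ(x, ·, ν)`, where `ν` is
the second marginal of `γ`. -/
def IsCournotNash (Φ : 𝒳 → 𝒴 → Measure 𝒴 → ℝ≥0∞) (μ : ProbabilityMeasure 𝒳)
    (γ : ProbabilityMeasure (𝒳 × 𝒴)) : Prop :=
  γ ∈ plans 𝒴 μ ∧
    ∀ᵐ p ∂(γ : Measure (𝒳 × 𝒴)), ∀ y' : 𝒴,
      Φ p.1 p.2 ((γ : Measure (𝒳 × 𝒴)).map Prod.snd)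
        ≤ Φ p.1 y' ((γ : Measure (𝒳 × 𝒴)).map Prod.snd)

/-- Mixed open-loop strategies: measurable families `(ν^x)` of probability measures on `𝒴`. -/
abbrev Strategy (𝒳 𝒴 : Type*) [MeasurableSpace 𝒳] [MeasurableSpace 𝒴] : Type _ :=
  {κ : Kernel 𝒳 𝒴 // IsMarkovKernel κ}

/-- The approximation condition: for every `n` there are `0 < C_n < ∞` and a measurable family
`(ν_n^y)` of probability measures on `𝒴` such that, for all `y, y'` and `x, ν` with
`Φ(x, y, ν) < ∞`, one has `𝓗(ν_n^y, ν_n^{y'}) ≤ C_n (1 + L(y) + L(y'))` for every `n`, and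
`∫ Φ(x, z, ν) dν_n^y(z) → Φ(x, y, ν)` as `n → ∞`. -/
def ApproximationCondition (c : 𝒳 × 𝒴 → ℝ≥0∞) (L : 𝒴 → ℝ≥0∞) (H : 𝒴 × 𝒴 → ℝ≥0∞) : Prop :=
  ∃ (C : ℕ → ℝ≥0) (κ : ℕ → Strategy 𝒴 𝒴), (∀ n, 0 < C n) ∧
    ∀ (x : 𝒳) (y y' : 𝒴) (ν : ProbabilityMeasure 𝒴), socialCost c L H x y ν < ∞ →
      (∀ n, interH H ((κ n).1 y) ((κ n).1 y') ≤ C n * (1 + L y + L y')) ∧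
      Tendsto (fun n => ∫⁻ z, socialCost c L H x z ν ∂((κ n).1 y)) atTop
        (𝓝 (socialCost c L H x y ν))

/-! ### The open-loop `N`-player game -/

variable {Ω : Type*} [MeasurableSpace Ω]

/-- The cost of player `i` when the profile of strategies is `κ`:
`𝔼[∫ c(X_i, y) dν_i^{X_i}(y) + 𝓛(ν_i^{X_i}) + (2/N) ∑_{j ≠ i} 𝓗(ν_i^{X_i}, ν_j^{X_j})]`. -/
def playerCost (c : 𝒳 × 𝒴 → ℝ≥0∞) (L : 𝒴 → ℝ≥0∞) (H : 𝒴 × 𝒴 → ℝ≥0∞) (P : Measure Ω)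
    (X : ℕ → Ω → 𝒳) {N : ℕ} (i : Fin N) (κ : Fin N → Strategy 𝒳 𝒴) : ℝ≥0∞ :=
  ∫⁻ ω, (∫⁻ y, c (X i ω, y) ∂((κ i).1 (X i ω)) + meanL L ((κ i).1 (X i ω))
    + 2 / (N : ℝ≥0∞) * ∑ j ∈ Finset.univ.erase i,
        interH H ((κ i).1 (X i ω)) ((κ j).1 (X j ω))) ∂P

/-- Nash equilibria of the open-loop game: no player gains by a unilateral deviation to another
open-loop strategy. -/
def IsOpenLoopNash (c : 𝒳 × 𝒴 → ℝ≥0∞) (L : 𝒴 → ℝ≥0∞) (H : 𝒴 × 𝒴 → ℝ≥0∞) (P : Measure Ω)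
    (X : ℕ → Ω → 𝒳) {N : ℕ} (κ : Fin N → Strategy 𝒳 𝒴) : Prop :=
  ∀ (i : Fin N) (κ' : Strategy 𝒳 𝒴),
    playerCost c L H P X i κ ≤ playerCost c L H P X i (Function.update κ i κ')

/-- `γ = (1/N) ∑_i δ_{X_i} ⊗ ν_i^{X_i}` almost surely, where `κ = (ν_i)` is the profile. -/
def IsInducedBy (P : Measure Ω) (X : ℕ → Ω → 𝒳) {N : ℕ} (κ : Fin N → Strategy 𝒳 𝒴)
    (γ : RandomPM Ω (𝒳 × 𝒴)) : Prop :=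
  ∀ᵐ ω ∂P, (γ.1 ω : Measure (𝒳 × 𝒴))
    = (N : ℝ≥0∞)⁻¹ • ∑ i : Fin N, (Measure.dirac (X i ω)).prod ((κ i).1 (X i ω))

/-- The potential `𝓙_{Ω,N}(γ) = 𝔼[∫ c dγ + (1/N) ∑_i 𝓛(ν_i^{X_i})
+ (1/N²) ∑_{i ≠ j} 𝓗(ν_i^{X_i}, ν_j^{X_j})]` if `γ` is induced by a profile `(ν_i)`, and `+∞`
otherwise. The infimum runs over the profiles inducing `γ` (and is `+∞` if there is none); when
the `X_i` are almost surely distinct, all of them give the same value. -/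
def openLoopPotential (c : 𝒳 × 𝒴 → ℝ≥0∞) (L : 𝒴 → ℝ≥0∞) (H : 𝒴 × 𝒴 → ℝ≥0∞) (P : Measure Ω)
    (X : ℕ → Ω → 𝒳) (N : ℕ) (γ : RandomPM Ω (𝒳 × 𝒴)) : ℝ≥0∞ :=
  ⨅ (κ : Fin N → Strategy 𝒳 𝒴) (_ : IsInducedBy P X κ γ),
    ∫⁻ ω, (∫⁻ p, c p ∂(γ.1 ω : Measure (𝒳 × 𝒴))
      + (N : ℝ≥0∞)⁻¹ * ∑ i : Fin N, meanL L ((κ i).1 (X i ω))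
      + ((N : ℝ≥0∞) ^ 2)⁻¹ * ∑ i : Fin N, ∑ j ∈ Finset.univ.erase i,
          interH H ((κ i).1 (X i ω)) ((κ j).1 (X j ω))) ∂P

end Costs

end CournotNash

end

noncomputable section

namespace CournotNash

open scoped BoundedContinuousFunction

/-! The open-loop game is a potential game. The strategy of player `i` sees only `X i`, and for `i ≠
j` the pair `(X i, X j)` has law `μ ⊗ μ`; hence expected costs depend only on the plans `μ ⊗ₘ κ i`
and their second marginals (`playerCost_eq`, `lintegral_potential_eq`). The interactions of player
`i` enter the potential twice, as `(i, j)` and as `(j, i)`. By symmetry of `H`, the potential is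
therefore `1/N` times the cost of player `i` plus a term free of the strategy of `i`, and minimizers
of finite potential are Nash equilibria (`isOpenLoopNash_of_isMinOn`).

Let `η` be the average of the plans `μ ⊗ₘ κ i`. Against a bounded continuous `g`, the induced random
measure differs from `η` by a centred mean of `N` independent variables, of variance at most `‖g‖² /
N` (`integral_sq_sub_le`). So narrow limits are deterministic and are weak limits of `η`
(`exists_const_limit`); conversely, weak convergence of `η` along a sparse sequence gives almost
sure weak convergence of the random measures (`ae_tendsto_of_summable`).

For minimizers, the potentials Γ-converge to the energy. Symmetric profiles give the upper bound
(`openLoopPotential_le_energy`), compact sublevels of `L` give tightness, and truncating `H` makes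
the missing diagonal terms negligible (`energy_le_of_tendsto`). The limit thus minimizes the energy.
Its first variation along segments of plans is the integral of `Φ`, so the limit should beat the
best response `T`. The law of `T` may have infinite self-interaction, which is why `T` is first
spread out by condition (A) (`isCournotNash_of_minimizer`).

For arbitrary Nash equilibria with `0 ≤ H ≤ M`, including self-interaction costs at most `2M/N`.
Averaging the Nash inequalities for a common deviation gives an inequality for `η` that passes to
the limit, by lower semicontinuity on the left and continuity of `H` on the right
(`isCournotNash_of_isOpenLoopNash`). -/

lemma exists_seq_basis (Y : Type*) [TopologicalSpace Y] [SecondCountableTopology Y] :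
    ∃ U : ℕ → Set Y, TopologicalSpace.IsTopologicalBasis (Set.range U) := by
  obtain ⟨B, hBc, -, hB⟩ := TopologicalSpace.exists_countable_basis Y
  obtain ⟨U, hU⟩ := (hBc.insert ∅).exists_eq_range (Set.insert_nonempty _ _)
  exact ⟨U, hU ▸ hB.insert_empty⟩

/-! ### Lower semicontinuous functions and weak convergence -/

section Weak

variable {Z : Type*} [MeasurableSpace Z] [TopologicalSpace Z]

lemma lintegral_eq_iSup_lintegral_min [OpensMeasurableSpace Z] {f : Z → ℝ≥0∞}
    (hf : Measurable f) (μ : Measure Z) :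
    ∫⁻ z, f z ∂μ = ⨆ n : ℕ, ∫⁻ z, min (f z) n ∂μ := by
  rw [← lintegral_iSup (fun n => hf.min measurable_const)
    (fun m n h z => min_le_min le_rfl (by exact_mod_cast h))]
  refine lintegral_congr fun z => ?_
  refine le_antisymm ?_ (iSup_le fun n => min_le_left _ _)
  rcases eq_or_ne (f z) ∞ with h | h
  · simp [h, ENNReal.iSup_natCast]
  · obtain ⟨n, hn⟩ := ENNReal.exists_nat_gt h
    exact (le_min le_rfl hn.le).trans (le_iSup (fun n : ℕ => min (f z) (n : ℝ≥0∞)) n)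

/-- Lower semicontinuity of integrals of lower semicontinuous functions under weak convergence. -/
lemma lintegral_le_liminf_of_lowerSemicontinuous [HasOuterApproxClosed Z] [OpensMeasurableSpace Z]
    {f : Z → ℝ≥0∞} (hf : LowerSemicontinuous f) {μs : ℕ → ProbabilityMeasure Z}
    {μ : ProbabilityMeasure Z} (h : Tendsto μs atTop (𝓝 μ)) :
    ∫⁻ z, f z ∂(μ : Measure Z) ≤ liminf (fun n => ∫⁻ z, f z ∂(μs n : Measure Z)) atTop := by
  -- Layer-cake formula. After it, Fatou in `t` and the portmanteau inequality for the open
  -- superlevel sets conclude; truncation at `n` keeps `toReal` faithful.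
  have key : ∀ (ν : Measure Z) (n : ℕ), ∫⁻ z, min (f z) n ∂ν
      = ∫⁻ t in Set.Ioi (0 : ℝ), ν {z | t < (min (f z) n).toReal} := by
    intro ν n
    rw [← lintegral_eq_lintegral_meas_lt ν (f := fun z => (min (f z) n).toReal)
      (Eventually.of_forall fun z => ENNReal.toReal_nonneg)
      (hf.measurable.min measurable_const).ennreal_toReal.aemeasurable]
    refine lintegral_congr fun z => ?_
    rw [ENNReal.ofReal_toReal]
    exact ((min_le_right _ _).trans_lt (ENNReal.natCast_lt_top n)).ne
  rw [lintegral_eq_iSup_lintegral_min hf.measurable]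
  refine iSup_le fun n => ?_
  calc ∫⁻ z, min (f z) n ∂(μ : Measure Z)
      ≤ liminf (fun k => ∫⁻ z, min (f z) n ∂(μs k : Measure Z)) atTop := by
        simp_rw [key]
        refine le_trans ?_ (lintegral_liminf_le fun k => Antitone.measurable fun s t hst =>
          measure_mono fun ω hω => lt_of_le_of_lt hst hω)
        refine setLIntegral_mono' measurableSet_Ioi fun t ht => ?_
        have ho : IsOpen {z | t < (min (f z) n).toReal} := by
          have : {z | t < (min (f z) n).toReal}
              = (fun z => min (f z) n) ⁻¹' Set.Ioi (ENNReal.ofReal t) := by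
            ext z
            have hfin : min (f z) (n : ℝ≥0∞) ≠ ∞ :=
              ((min_le_right _ _).trans_lt (ENNReal.natCast_lt_top n)).ne
            simp only [Set.mem_ofPred_eq, Set.mem_preimage, Set.mem_Ioi]
            rw [ENNReal.ofReal_lt_iff_lt_toReal (le_of_lt ht) hfin]
          rw [this]
          exact (hf.inf lowerSemicontinuous_const).isOpen_preimage _
        exact ProbabilityMeasure.le_liminf_measure_open_of_tendsto h ho
    _ ≤ _ := liminf_le_liminf
      (Eventually.of_forall fun k => lintegral_mono fun z => min_le_left _ _)

/-- A countable family of bounded continuous functions which determines weak convergence. -/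
lemma exists_convergenceDetermining [PolishSpace Z] [BorelSpace Z] :
    ∃ g : ℕ → BoundedContinuousFunction Z ℝ, ∀ (μs : ℕ → ProbabilityMeasure Z)
      (μ : ProbabilityMeasure Z),
      (∀ k, Tendsto (fun n => ∫ z, g k z ∂(μs n : Measure Z)) atTop
        (𝓝 (∫ z, g k z ∂(μ : Measure Z)))) → Tendsto μs atTop (𝓝 μ) := by
  classical
  obtain ⟨U, hU⟩ := exists_seq_basis Z
  -- The complements of finite unions of basic open sets form a countable family of closed sets; the
  -- test functions are their continuous approximations from above.
  let K : Finset ℕ → Set Z := fun t => (⋃ n ∈ t, U n)ᶜ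
  have hK : ∀ t, IsClosed (K t) := fun t =>
    (isOpen_biUnion fun n _ => hU.isOpen (Set.mem_range_self n)).isClosed_compl
  obtain ⟨i, hi⟩ := exists_surjective_nat (Finset ℕ × ℕ)
  refine ⟨fun k => BoundedContinuousFunction.ofNormedAddCommGroup
    (fun z => ((hK (i k).1).apprSeq (i k).2 z : ℝ)) (by fun_prop) 1
    (fun z => by simpa using HasOuterApproxClosed.apprSeq_apply_le_one (hK (i k).1) (i k).2 z),
    fun μs μ h => ?_⟩
  have happr : ∀ t m, Tendsto (fun n => ∫⁻ z, (hK t).apprSeq m z ∂(μs n : Measure Z)) atTop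
      (𝓝 (∫⁻ z, (hK t).apprSeq m z ∂(μ : Measure Z))) := by
    intro t m
    obtain ⟨k, hk⟩ := hi (t, m)
    have hk' := h k
    simp only [BoundedContinuousFunction.coe_ofNormedAddCommGroup, hk] at hk'
    simp_rw [← BoundedContinuousFunction.toReal_lintegral_coe_eq_integral] at hk'
    exact (ENNReal.tendsto_toReal_iff
      (fun n => (BoundedContinuousFunction.lintegral_lt_top_of_nnreal _ _).ne)
      (BoundedContinuousFunction.lintegral_lt_top_of_nnreal _ _).ne).1 hk'
  refine tendsto_of_forall_isClosed_limsup_le' fun F hF => ?_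
  -- A closed `F` is the decreasing intersection of the `K (t j)`, so the portmanteau bound for `F`
  -- follows by letting first `m` and then `j` tend to infinity.
  let t : ℕ → Finset ℕ := fun j => (Finset.range j).filter fun n => U n ⊆ Fᶜ
  have ht_mono : Monotone t := fun a b hab =>
    Finset.filter_subset_filter _ (Finset.range_mono hab)
  have hF_sub : ∀ j, F ⊆ K (t j) := by
    intro j z hz hz'
    simp only [Set.mem_iUnion] at hz'
    obtain ⟨n, hn, hzn⟩ := hz'
    exact (Finset.mem_filter.1 hn).2 hzn hz
  have hF_eq : ⋂ j, K (t j) = F := by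
    refine Set.Subset.antisymm (fun z hz => ?_) (Set.subset_iInter hF_sub)
    by_contra hzF
    obtain ⟨_, ⟨n, rfl⟩, hzn, hn⟩ := hU.exists_subset_of_mem_open (a := z) hzF hF.isOpen_compl
    refine (Set.mem_iInter.1 hz (n + 1)) ?_
    simp only [Set.mem_iUnion]
    exact ⟨n, Finset.mem_filter.2 ⟨by simp, hn⟩, hzn⟩
  have hlim : Tendsto (fun j => (μ : Measure Z) (K (t j))) atTop (𝓝 ((μ : Measure Z) F)) := by
    have := tendsto_measure_iInter_atTop (μ := (μ : Measure Z)) (s := fun j => K (t j))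
      (fun j => (hK _).measurableSet.nullMeasurableSet)
      (fun a b hab => Set.compl_subset_compl.2
        (Set.biUnion_subset_biUnion_left (ht_mono hab))) ⟨0, measure_ne_top _ _⟩
    rwa [hF_eq] at this
  refine ge_of_tendsto' hlim fun j => ?_
  refine ge_of_tendsto' (HasOuterApproxClosed.tendsto_lintegral_apprSeq (hK (t j))
    (μ : Measure Z)) fun m => ?_
  rw [← (happr (t j) m).limsup_eq]
  refine limsup_le_limsup (Eventually.of_forall fun n => ?_)
  exact (measure_mono (hF_sub j)).trans
    (HasOuterApproxClosed.measure_le_lintegral (hK (t j)) _ m)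

/-- For lower semicontinuous `H ≥ 0` the function `y ↦ ∫ H(y, y') dν(y')` is lower
semicontinuous. -/
lemma lowerSemicontinuous_lintegral_prodMk {Y : Type*} [TopologicalSpace Y]
    [FirstCountableTopology Y] [OpensMeasurableSpace Z] {H : Y × Z → ℝ≥0∞}
    (hH : LowerSemicontinuous H)
    (ν : Measure Z) : LowerSemicontinuous fun y => ∫⁻ z, H (y, z) ∂ν := by
  intro y b hb
  by_contra hcon
  -- First countability reduces the claim to sequences, where Fatou applies.
  obtain ⟨u, hu, hub⟩ := exists_seq_forall_of_frequently (not_eventually.1 hcon)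
  have hm : ∀ y, Measurable fun z => H (y, z) := fun y =>
    (hH.comp (g := fun z => (y, z)) (by fun_prop)).measurable
  refine absurd hb (not_lt.2 ?_)
  calc ∫⁻ z, H (y, z) ∂ν ≤ ∫⁻ z, liminf (fun n => H (u n, z)) atTop ∂ν := by
        refine lintegral_mono fun z => ?_
        have h1 := (lowerSemicontinuousAt_iff_le_liminf.1 (hH.lowerSemicontinuousAt (y, z)))
        have h2 : Tendsto (fun n => (u n, z)) atTop (𝓝 (y, z)) :=
          hu.prodMk_nhds tendsto_const_nhds
        refine h1.trans ?_
        rw [liminf_eq, liminf_eq]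
        exact sSup_le_sSup fun a ha => h2.eventually ha
    _ ≤ liminf (fun n => ∫⁻ z, H (u n, z) ∂ν) atTop := lintegral_liminf_le fun n => hm _
    _ ≤ b := liminf_le_of_frequently_le' (Eventually.of_forall fun n => not_lt.1 (hub n)).frequently

end Weak

/-! ### Measurable selection of minimizers -/

section Selection

variable {Y : Type*} [TopologicalSpace Y]

/-- A lower semicontinuous function with compact sublevel sets attains its infimum on every
nonempty closed set. -/
lemma exists_isMinOn_of_isCompact_sublevel {f : Y → ℝ≥0∞} (hf : LowerSemicontinuous f)
    (hcomp : ∀ r : ℝ≥0, 0 < r → IsCompact {y | f y ≤ r}) {C : Set Y} (hC : IsClosed C)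
    (hne : C.Nonempty) : ∃ y ∈ C, ∀ y' ∈ C, f y ≤ f y' := by
  by_cases h : ∃ y₀ ∈ C, f y₀ < ∞
  · obtain ⟨y₀, hy₀, hfin⟩ := h
    -- The `+ 1` makes the level positive, since compactness is assumed only for positive levels.
    set r : ℝ≥0 := (f y₀).toNNReal + 1
    have hr : f y₀ ≤ r := by
      simp only [r, ENNReal.coe_add, ENNReal.coe_toNNReal hfin.ne]
      exact le_self_add
    have hK : IsCompact ({y | f y ≤ r} ∩ C) := (hcomp r (by positivity)).inter_right hC
    have hne' : ({y | f y ≤ r} ∩ C).Nonempty := ⟨y₀, hr, hy₀⟩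
    obtain ⟨y, hy, hmin⟩ := (hf.lowerSemicontinuousOn _).exists_isMinOn hne' hK
    refine ⟨y, hy.2, fun y' hy' => ?_⟩
    by_cases hle : f y' ≤ r
    · exact hmin ⟨hle, hy'⟩
    · exact hy.1.trans (not_le.1 hle).le
  · push Not at h
    obtain ⟨y, hy⟩ := hne
    exact ⟨y, hy, fun y' hy' => le_top.trans (h y' hy')⟩

/-- On a second-countable T₀ space there is an injective lower semicontinuous function. -/
lemma exists_lowerSemicontinuous_injective [SecondCountableTopology Y] [T0Space Y] :
    ∃ e : Y → ℝ≥0∞, LowerSemicontinuous e ∧ Function.Injective e := by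
  classical
  obtain ⟨U, hB⟩ := exists_seq_basis Y
  let b : Y → ℕ → Bool := fun y n => decide (y ∈ U n)
  have hb : Function.Injective b := by
    intro x y hxy
    refine (Inseparable.eq ?_)
    refine (hB.inseparable_iff).2 ?_
    intro s hs
    obtain ⟨n, rfl⟩ := hs
    have := congrFun hxy n
    simpa [b] using this
  have hsum : ∀ y, Summable (Cardinal.cantorFunctionAux (1 / 3) (b y)) := fun y =>
    Cardinal.summable_cantor_function _ (by norm_num) (by norm_num)
  -- Indicators of open sets are lower semicontinuous. The weights `3⁻ⁿ` turn the membership bits of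
  -- `y` into the Cantor function, injective because `1/3 < 1/2`; the bits separate points by T₀.
  refine ⟨fun y => ∑' n, (U n).indicator (fun _ => ENNReal.ofReal ((1 / 3) ^ n)) y, ?_, ?_⟩
  · refine lowerSemicontinuous_tsum fun n => IsOpen.lowerSemicontinuous_indicator ?_ bot_le
    exact hB.isOpen (Set.mem_range_self n)
  · have he : ∀ y, ∑' n, (U n).indicator (fun _ => ENNReal.ofReal ((1 / 3) ^ n)) y
        = ENNReal.ofReal (Cardinal.cantorFunction (1 / 3) (b y)) := by
      intro y
      rw [Cardinal.cantorFunction, ENNReal.ofReal_tsum_of_nonneg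
        (fun n => Cardinal.cantorFunctionAux_nonneg (by norm_num)) (hsum y)]
      refine tsum_congr fun n => ?_
      by_cases hy : y ∈ U n <;> simp [b, Cardinal.cantorFunctionAux, hy]
    intro x y hxy
    simp only [he] at hxy
    rw [ENNReal.ofReal_eq_ofReal_iff] at hxy
    · exact hb (Cardinal.cantorFunction_injective (by norm_num) (by norm_num) hxy)
    all_goals exact tsum_nonneg fun n => Cardinal.cantorFunctionAux_nonneg (by norm_num)

variable {X : Type*} [TopologicalSpace X] {F : X × Y → ℝ≥0∞} {L : Y → ℝ≥0∞}

/-- The partial infimum over a closed set of a lower semicontinuous function dominating a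
function with compact sublevel sets is lower semicontinuous. -/
lemma lowerSemicontinuous_biInf (hF : LowerSemicontinuous F)
    (hL_compact : ∀ r : ℝ≥0, 0 < r → IsCompact {y | L y ≤ r}) (hLF : ∀ x y, L y ≤ F (x, y))
    {C : Set Y} (hC : IsClosed C) : LowerSemicontinuous fun x => ⨅ y ∈ C, F (x, y) := by
  intro x b hb
  obtain ⟨b', hbb', hb'⟩ := exists_between hb
  lift b' to ℝ≥0 using hb'.ne_top
  have hpos : 0 < b' := by exact_mod_cast pos_of_gt hbb'
  have hK : IsCompact ({y | L y ≤ b'} ∩ C) := (hL_compact b' hpos).inter_right hC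
  -- Tube lemma on the compact part `L ≤ b'`; off it, `F ≥ L > b'` for every `x`.
  have hev := hK.eventually_forall_of_forall_eventually (x₀ := x)
    (P := fun x y => (b' : ℝ≥0∞) < F (x, y)) (fun y hy => hF.lowerSemicontinuousAt (x, y) _
      (hb'.trans_le (iInf₂_le y hy.2)))
  filter_upwards [hev] with z hz
  refine hbb'.trans_le (le_iInf₂ fun y hy => ?_)
  by_cases hy' : L y ≤ b'
  · exact (hz y ⟨hy', hy⟩).le
  · exact (not_le.1 hy').le.trans (hLF z y)

/-- Measurable selection of minimizers. -/
theorem exists_measurable_argmin [PolishSpace Y] [Nonempty Y] [MeasurableSpace Y] [BorelSpace Y]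
    [MeasurableSpace X] [OpensMeasurableSpace X]
    (hF : LowerSemicontinuous F)
    (hL_compact : ∀ r : ℝ≥0, 0 < r → IsCompact {y | L y ≤ r}) (hLF : ∀ x y, L y ≤ F (x, y)) :
    ∃ T : X → Y, Measurable T ∧ ∀ x y, F (x, T x) ≤ F (x, y) := by
  obtain ⟨e, he, he_inj⟩ := exists_lowerSemicontinuous_injective (Y := Y)
  have hFx : ∀ x, LowerSemicontinuous fun y => F (x, y) := fun x =>
    hF.comp (g := fun y => (x, y)) (by fun_prop)
  have hFcomp : ∀ x, ∀ r : ℝ≥0, 0 < r → IsCompact {y | F (x, y) ≤ r} := fun x r hr =>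
    (hL_compact r hr).of_isClosed_subset ((hFx x).isClosed_preimage r)
      fun y hy => (hLF x y).trans hy
  set m : X → ℝ≥0∞ := fun x => ⨅ y ∈ Set.univ, F (x, y) with hm_def
  have hm : Measurable m := (lowerSemicontinuous_biInf hF hL_compact hLF isClosed_univ).measurable
  have hm_le : ∀ x y, m x ≤ F (x, y) := fun x y => iInf₂_le y (Set.mem_univ y)
  -- Ties are broken by minimizing the injective `e` over the compact set of minimizers, which makes
  -- the choice unique; where `m x = ∞` every point is a minimizer and a fixed one is taken.
  have hT : ∀ x, ∃ y, (m x = ∞ → y = Classical.arbitrary Y) ∧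
      (m x < ∞ → F (x, y) ≤ m x ∧ ∀ y', F (x, y') ≤ m x → e y ≤ e y') := by
    intro x
    by_cases hx : m x = ∞
    · exact ⟨_, fun _ => rfl, fun h => absurd hx h.ne⟩
    · obtain ⟨y₀, -, hy₀⟩ := exists_isMinOn_of_isCompact_sublevel (hFx x) (hFcomp x) isClosed_univ
        Set.univ_nonempty
      have hy₀' : F (x, y₀) ≤ m x := le_iInf₂ hy₀
      have hA : IsCompact {y | F (x, y) ≤ m x} := by
        refine (hFcomp x ((m x).toNNReal + 1) (by positivity)).of_isClosed_subset
          ((hFx x).isClosed_preimage _) fun y (hy : F (x, y) ≤ m x) => hy.trans ?_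
        rw [ENNReal.coe_add, ENNReal.coe_toNNReal hx]
        exact le_self_add
      have hne : {y | F (x, y) ≤ m x}.Nonempty := ⟨y₀, hy₀'⟩
      obtain ⟨y, hy, hmin⟩ := (he.lowerSemicontinuousOn _).exists_isMinOn hne hA
      exact ⟨y, fun h => absurd h hx, fun _ => ⟨hy, fun y' hy' => hmin hy'⟩⟩
  choose T hT_top hT_fin using hT
  refine ⟨T, ?_, fun x y => ?_⟩
  · rw [← (he.measurable.measurableEmbedding he_inj).measurable_comp_iff]
    refine measurable_of_Iic fun r => ?_
    have hset : (e ∘ T) ⁻¹' Set.Iic r = ({x | m x = ∞} ∩ {_x | e (Classical.arbitrary Y) ≤ r}) ∪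
        ({x | m x < ∞} ∩ {x | ⨅ y ∈ {y | e y ≤ r}, F (x, y) ≤ m x}) := by
      ext x
      by_cases hx : m x = ∞
      · simp [hx, hT_top x hx]
      · have hx' : m x < ∞ := lt_top_iff_ne_top.2 hx
        have hx2 := hT_fin x hx'
        simp only [Set.mem_preimage, Function.comp, Set.mem_Iic, Set.mem_union, Set.mem_inter_iff,
          Set.mem_ofPred_eq, hx, hx', false_and, true_and, false_or]
        constructor
        · intro h
          exact (iInf₂_le (T x) h).trans hx2.1
        · intro h
          have hne : {y | e y ≤ r}.Nonempty := by
            by_contra hemp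
            have hall : ∀ y, ¬ e y ≤ r := fun y hy => hemp ⟨y, hy⟩
            simp only [hall, iInf_false, iInf_top, top_le_iff] at h
            exact hx h
          obtain ⟨y, hy, hmin⟩ := exists_isMinOn_of_isCompact_sublevel (hFx x) (hFcomp x)
            (he.isClosed_preimage r) hne
          exact (hx2.2 y ((le_iInf₂ hmin).trans h)).trans hy
    rw [hset]
    refine ((measurableSet_eq_fun hm measurable_const).inter (MeasurableSet.const _)).union
      ((measurableSet_lt hm measurable_const).inter (measurableSet_le ?_ hm))
    exact (lowerSemicontinuous_biInf hF hL_compact hLF (he.isClosed_preimage r)).measurable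
  · by_cases hx : m x = ∞
    · exact le_top.trans (hx ▸ hm_le x y)
    · exact (hT_fin x (lt_top_iff_ne_top.2 hx)).1.trans (hm_le x y)

end Selection

/-! ### Averages of finitely many measures and bilinearity of the interaction energy -/

section Average

variable {Z : Type*} [MeasurableSpace Z]

/-- The average of finitely many measures. -/
def average {N : ℕ} (m : Fin N → Measure Z) : Measure Z := (N : ℝ≥0∞)⁻¹ • ∑ i, m i

lemma lintegral_average {N : ℕ} (m : Fin N → Measure Z) (f : Z → ℝ≥0∞) :
    ∫⁻ z, f z ∂(average m) = (N : ℝ≥0∞)⁻¹ * ∑ i, ∫⁻ z, f z ∂(m i) := by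
  rw [average, lintegral_smul_measure, lintegral_finsetSum_measure, smul_eq_mul]

lemma natCast_inv_mul_sum_const {N : ℕ} (hN : 1 ≤ N) (a : ℝ≥0∞) :
    (N : ℝ≥0∞)⁻¹ * ∑ _i : Fin N, a = a := by
  rw [Finset.sum_const, Finset.card_univ, Fintype.card_fin, nsmul_eq_mul, ← mul_assoc,
    ENNReal.inv_mul_cancel (by exact_mod_cast (by omega)) (by simp), one_mul]

lemma isProbabilityMeasure_average {N : ℕ} (hN : 1 ≤ N) (m : Fin N → Measure Z)
    [∀ i, IsProbabilityMeasure (m i)] : IsProbabilityMeasure (average m) := by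
  refine ⟨?_⟩
  rw [← lintegral_one, lintegral_average]
  simpa using natCast_inv_mul_sum_const hN 1

lemma map_average {W : Type*} [MeasurableSpace W] {N : ℕ} (m : Fin N → Measure Z) {f : Z → W}
    (hf : Measurable f) : (average m).map f = average fun i => (m i).map f := by
  ext s hs
  simp [average, Measure.map_apply hf hs, Measure.finsetSum_apply]

lemma average_const {N : ℕ} (hN : 1 ≤ N) (m : Measure Z) : average (fun _ : Fin N => m) = m := by
  ext s hs
  simpa [average, Measure.finsetSum_apply] using natCast_inv_mul_sum_const hN (m s)

lemma interH_eq_lintegral {H : Z × Z → ℝ≥0∞} (hH : Measurable H) (ν ν' : Measure Z) [SFinite ν'] :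
    interH H ν ν' = ∫⁻ y, ∫⁻ y', H (y, y') ∂ν' ∂ν := by
  rw [interH, lintegral_prod _ hH.aemeasurable]

lemma interH_comm {H : Z × Z → ℝ≥0∞} (hH : Measurable H) (hsymm : ∀ y y', H (y, y') = H (y', y))
    (ν ν' : Measure Z) [SFinite ν] [SFinite ν'] : interH H ν ν' = interH H ν' ν := by
  rw [interH_eq_lintegral hH, interH, lintegral_prod_symm _ hH.aemeasurable]
  simp_rw [hsymm]

lemma interH_average_left {H : Z × Z → ℝ≥0∞} (hH : Measurable H) {N : ℕ} (m : Fin N → Measure Z)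
    (ν : Measure Z) [SFinite ν] :
    interH H (average m) ν = (N : ℝ≥0∞)⁻¹ * ∑ i, interH H (m i) ν := by
  simp_rw [interH_eq_lintegral hH, lintegral_average]

lemma interH_average_right {H : Z × Z → ℝ≥0∞} (hH : Measurable H) {N : ℕ} (hN : 1 ≤ N)
    (ν : Measure Z) (m : Fin N → Measure Z) [∀ i, IsProbabilityMeasure (m i)] :
    interH H ν (average m) = (N : ℝ≥0∞)⁻¹ * ∑ i, interH H ν (m i) := by
  have := isProbabilityMeasure_average hN m
  have hm : ∀ i, Measurable fun y => ∫⁻ y', H (y, y') ∂(m i) := fun i => hH.lintegral_prod_right'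
  simp_rw [interH_eq_lintegral hH, lintegral_average]
  rw [lintegral_const_mul _ (Finset.measurable_sum _ fun i _ => hm i),
    lintegral_finsetSum _ fun i _ => hm i]

end Average

/-! ### Costs and potentials in terms of the laws of the strategies -/

section Game

variable {𝒳 𝒴 : Type*} [MeasurableSpace 𝒳] [MeasurableSpace 𝒴]

instance (κ : Strategy 𝒳 𝒴) : IsMarkovKernel κ.1 := κ.2

lemma lintegral_comp_eq (μ : Measure 𝒳) (κ : Kernel 𝒳 𝒴) {f : 𝒴 → ℝ≥0∞} (hf : Measurable f) :
    ∫⁻ y, f y ∂(κ ∘ₘ μ) = ∫⁻ x, ∫⁻ y, f y ∂(κ x) ∂μ :=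
  Measure.lintegral_bind κ.measurable.aemeasurable hf.aemeasurable

lemma measurable_interH {H : 𝒴 × 𝒴 → ℝ≥0∞} (hH : Measurable H) (κ κ' : Kernel 𝒳 𝒴)
    [IsMarkovKernel κ] [IsMarkovKernel κ'] :
    Measurable fun p : 𝒳 × 𝒳 => interH H (κ p.1) (κ' p.2) := by
  have : (fun p : 𝒳 × 𝒳 => interH H (κ p.1) (κ' p.2))
      = fun p => ∫⁻ q, H q ∂((κ ∥ₖ κ') p) := by
    ext p
    rw [Kernel.parallelComp_apply, interH]
  rw [this]
  exact hH.lintegral_kernel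

lemma interH_comp {H : 𝒴 × 𝒴 → ℝ≥0∞} (hH : Measurable H) (μ : Measure 𝒳)
    [IsProbabilityMeasure μ] (κ κ' : Kernel 𝒳 𝒴) [IsMarkovKernel κ] [IsMarkovKernel κ'] :
    interH H (κ ∘ₘ μ) (κ' ∘ₘ μ) = ∫⁻ p, interH H (κ p.1) (κ' p.2) ∂(μ.prod μ) := by
  rw [lintegral_prod _ (measurable_interH hH κ κ').aemeasurable, interH_eq_lintegral hH,
    lintegral_comp_eq _ _ hH.lintegral_prod_right']
  refine lintegral_congr fun x => ?_
  have h1 : ∀ y, ∫⁻ y', H (y, y') ∂(κ' ∘ₘ μ) = ∫⁻ x', ∫⁻ y', H (y, y') ∂(κ' x') ∂μ := fun y =>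
    lintegral_comp_eq _ _ (hH.comp measurable_prodMk_left)
  simp_rw [h1, interH_eq_lintegral hH]
  refine lintegral_lintegral_swap (Measurable.aemeasurable ?_)
  -- A kernel with a dummy variable, used for the joint measurability that Tonelli requires.
  let η : Kernel (𝒴 × 𝒳) 𝒴 := κ'.comap Prod.snd measurable_snd
  exact Measurable.lintegral_kernel_prod_right (κ := η) (f := fun p y' => H (p.1, y'))
    (hH.comp (by fun_prop))

variable {Ω : Type*} [MeasurableSpace Ω] {P : Measure Ω} {μ : Measure 𝒳} {X : ℕ → Ω → 𝒳}

lemma map_pair_eq_prod [IsProbabilityMeasure P] (hX_meas : ∀ i, Measurable (X i))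
    (hX_indep : iIndepFun X P)
    (hX_law : ∀ i, P.map (X i) = μ) {i j : ℕ} (hij : i ≠ j) :
    P.map (fun ω => (X i ω, X j ω)) = μ.prod μ := by
  rw [(indepFun_iff_map_prod_eq_prod_map_map (hX_meas i).aemeasurable
    (hX_meas j).aemeasurable).1 (hX_indep.indepFun hij), hX_law, hX_law]

/-- Distinct players are independent, so their joint type has law `μ ⊗ μ` and bilinearity moves the
expectation onto the strategies. This is why only averaged strategies matter. -/
lemma lintegral_interH_pair [IsProbabilityMeasure P] [IsProbabilityMeasure μ]
    (hX_meas : ∀ i, Measurable (X i)) (hX_indep : iIndepFun X P)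
    (hX_law : ∀ i, P.map (X i) = μ) {H : 𝒴 × 𝒴 → ℝ≥0∞} (hH : Measurable H) {i j : ℕ} (hij : i ≠ j)
    (κ κ' : Kernel 𝒳 𝒴) [IsMarkovKernel κ] [IsMarkovKernel κ'] :
    ∫⁻ ω, interH H (κ (X i ω)) (κ' (X j ω)) ∂P = interH H (κ ∘ₘ μ) (κ' ∘ₘ μ) := by
  rw [interH_comp hH, ← map_pair_eq_prod hX_meas hX_indep hX_law hij,
    lintegral_map (measurable_interH hH κ κ') ((hX_meas i).prodMk (hX_meas j))]

lemma lintegral_meanL_comp (hX_meas : ∀ i, Measurable (X i)) (hX_law : ∀ i, P.map (X i) = μ)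
    {L : 𝒴 → ℝ≥0∞} (hL : Measurable L) (i : ℕ) (κ : Kernel 𝒳 𝒴) [IsMarkovKernel κ] :
    ∫⁻ ω, meanL L (κ (X i ω)) ∂P = meanL L (κ ∘ₘ μ) := by
  rw [meanL, lintegral_comp_eq _ _ hL, ← hX_law i, lintegral_map (hL.lintegral_kernel) (hX_meas i)]
  rfl

lemma measurable_lintegral_section {c : 𝒳 × 𝒴 → ℝ≥0∞} (hc : Measurable c) (κ : Kernel 𝒳 𝒴)
    [IsMarkovKernel κ] : Measurable fun x => ∫⁻ y, c (x, y) ∂(κ x) :=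
  Measurable.lintegral_kernel_prod_right (f := fun x y => c (x, y)) hc

lemma lintegral_section_comp [IsProbabilityMeasure μ] (hX_meas : ∀ i, Measurable (X i))
    (hX_law : ∀ i, P.map (X i) = μ)
    {c : 𝒳 × 𝒴 → ℝ≥0∞} (hc : Measurable c) (i : ℕ) (κ : Kernel 𝒳 𝒴) [IsMarkovKernel κ] :
    ∫⁻ ω, ∫⁻ y, c (X i ω, y) ∂(κ (X i ω)) ∂P = ∫⁻ p, c p ∂(μ ⊗ₘ κ) := by
  rw [Measure.lintegral_compProd hc, ← hX_law i,
    lintegral_map (measurable_lintegral_section hc κ) (hX_meas i)]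

/-- By independence the cost of a player only depends on the laws of the strategies. -/
lemma playerCost_eq [IsProbabilityMeasure P] [IsProbabilityMeasure μ]
    (hX_meas : ∀ i, Measurable (X i)) (hX_indep : iIndepFun X P)
    (hX_law : ∀ i, P.map (X i) = μ) {c : 𝒳 × 𝒴 → ℝ≥0∞} {L : 𝒴 → ℝ≥0∞} {H : 𝒴 × 𝒴 → ℝ≥0∞}
    (hc : Measurable c) (hL : Measurable L) (hH : Measurable H) {N : ℕ} (i : Fin N)
    (κ : Fin N → Strategy 𝒳 𝒴) :
    playerCost c L H P X i κ = ∫⁻ p, c p ∂(μ ⊗ₘ (κ i).1) + meanL L ((κ i).1 ∘ₘ μ)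
      + 2 / (N : ℝ≥0∞) * ∑ j ∈ Finset.univ.erase i,
        interH H ((κ i).1 ∘ₘ μ) ((κ j).1 ∘ₘ μ) := by
  have h1 : Measurable fun ω => ∫⁻ y, c (X i ω, y) ∂((κ i).1 (X i ω)) :=
    (measurable_lintegral_section hc (κ i).1).comp (hX_meas i)
  have h2 : Measurable fun ω => meanL L ((κ i).1 (X i ω)) :=
    (hL.lintegral_kernel (κ := (κ i).1)).comp (hX_meas i)
  have h3 : ∀ j, Measurable fun ω => interH H ((κ i).1 (X i ω)) ((κ j).1 (X j ω)) := fun j =>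
    (measurable_interH hH (κ i).1 (κ j).1).comp ((hX_meas i).prodMk (hX_meas j))
  have h12 : Measurable fun ω => ∫⁻ y, c (X i ω, y) ∂((κ i).1 (X i ω))
      + meanL L ((κ i).1 (X i ω)) := h1.add h2
  rw [playerCost, lintegral_add_left h12, lintegral_add_left h1,
    lintegral_const_mul _ (Finset.measurable_sum _ fun j _ => h3 j),
    lintegral_finsetSum _ fun j _ => h3 j, lintegral_section_comp hX_meas hX_law hc,
    lintegral_meanL_comp hX_meas hX_law hL]
  congr 2
  refine Finset.sum_congr rfl fun j hj => ?_
  exact lintegral_interH_pair hX_meas hX_indep hX_law hH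
    (fun h => (Finset.mem_erase.1 hj).1 (Fin.ext h.symm)) _ _

/-- The potential of a profile, in terms of the laws of the strategies. -/
def profilePotential (c : 𝒳 × 𝒴 → ℝ≥0∞) (L : 𝒴 → ℝ≥0∞) (H : 𝒴 × 𝒴 → ℝ≥0∞) (μ : Measure 𝒳)
    {N : ℕ} (κ : Fin N → Strategy 𝒳 𝒴) : ℝ≥0∞ :=
  (N : ℝ≥0∞)⁻¹ * ∑ i, (∫⁻ p, c p ∂(μ ⊗ₘ (κ i).1) + meanL L ((κ i).1 ∘ₘ μ))
    + ((N : ℝ≥0∞) ^ 2)⁻¹ * ∑ i, ∑ j ∈ Finset.univ.erase i,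
        interH H ((κ i).1 ∘ₘ μ) ((κ j).1 ∘ₘ μ)

lemma lintegral_potential_eq [IsProbabilityMeasure P] [IsProbabilityMeasure μ]
    (hX_meas : ∀ i, Measurable (X i)) (hX_indep : iIndepFun X P)
    (hX_law : ∀ i, P.map (X i) = μ) {c : 𝒳 × 𝒴 → ℝ≥0∞} {L : 𝒴 → ℝ≥0∞} {H : 𝒴 × 𝒴 → ℝ≥0∞}
    (hc : Measurable c) (hL : Measurable L) (hH : Measurable H) {N : ℕ}
    {κ : Fin N → Strategy 𝒳 𝒴} {γ : RandomPM Ω (𝒳 × 𝒴)} (hκ : IsInducedBy P X κ γ) :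
    ∫⁻ ω, (∫⁻ p, c p ∂(γ.1 ω : Measure (𝒳 × 𝒴))
      + (N : ℝ≥0∞)⁻¹ * ∑ i : Fin N, meanL L ((κ i).1 (X i ω))
      + ((N : ℝ≥0∞) ^ 2)⁻¹ * ∑ i : Fin N, ∑ j ∈ Finset.univ.erase i,
          interH H ((κ i).1 (X i ω)) ((κ j).1 (X j ω))) ∂P = profilePotential c L H μ κ := by
  have h1 : ∀ i : Fin N, Measurable fun ω => ∫⁻ y, c (X i ω, y) ∂((κ i).1 (X i ω)) := fun i =>
    (measurable_lintegral_section hc (κ i).1).comp (hX_meas i)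
  have h2 : ∀ i : Fin N, Measurable fun ω => meanL L ((κ i).1 (X i ω)) := fun i =>
    (hL.lintegral_kernel (κ := (κ i).1)).comp (hX_meas i)
  have h3 : ∀ i j : Fin N, Measurable fun ω => interH H ((κ i).1 (X i ω)) ((κ j).1 (X j ω)) :=
    fun i j => (measurable_interH hH (κ i).1 (κ j).1).comp ((hX_meas i).prodMk (hX_meas j))
  have h4 : Measurable fun ω => (N : ℝ≥0∞)⁻¹ * ∑ i : Fin N,
      ∫⁻ y, c (X i ω, y) ∂((κ i).1 (X i ω)) :=
    (Finset.measurable_sum _ fun i _ => h1 i).const_mul _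
  have h5 : Measurable fun ω => (N : ℝ≥0∞)⁻¹ * ∑ i : Fin N, meanL L ((κ i).1 (X i ω)) :=
    (Finset.measurable_sum _ fun i _ => h2 i).const_mul _
  have h45 : Measurable fun ω => (N : ℝ≥0∞)⁻¹ * ∑ i : Fin N,
      ∫⁻ y, c (X i ω, y) ∂((κ i).1 (X i ω))
      + (N : ℝ≥0∞)⁻¹ * ∑ i : Fin N, meanL L ((κ i).1 (X i ω)) := h4.add h5
  have h6 : ∀ i : Fin N, Measurable fun ω => ∑ j ∈ Finset.univ.erase i,
      interH H ((κ i).1 (X i ω)) ((κ j).1 (X j ω)) := fun i =>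
    Finset.measurable_sum _ fun j _ => h3 i j
  have hγ : ∀ᵐ ω ∂P, ∫⁻ p, c p ∂(γ.1 ω : Measure (𝒳 × 𝒴))
      = (N : ℝ≥0∞)⁻¹ * ∑ i : Fin N, ∫⁻ y, c (X i ω, y) ∂((κ i).1 (X i ω)) := by
    filter_upwards [hκ] with ω hω
    rw [hω, lintegral_smul_measure, lintegral_finsetSum_measure, smul_eq_mul]
    congr 1
    refine Finset.sum_congr rfl fun i _ => ?_
    rw [lintegral_prod _ hc.aemeasurable, lintegral_dirac' _ hc.lintegral_prod_right']
  rw [lintegral_congr_ae (hγ.mono fun ω hω => by rw [hω]),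
    lintegral_add_left h45, lintegral_add_left h4,
    lintegral_const_mul _ (Finset.measurable_sum _ fun i _ => h1 i),
    lintegral_const_mul _ (Finset.measurable_sum _ fun i _ => h2 i),
    lintegral_const_mul _ (Finset.measurable_sum _ fun i _ => h6 i),
    lintegral_finsetSum _ fun i _ => h1 i, lintegral_finsetSum _ fun i _ => h2 i,
    lintegral_finsetSum _ fun i _ => h6 i, profilePotential, ← mul_add, ← Finset.sum_add_distrib]
  simp_rw [lintegral_section_comp hX_meas hX_law hc, lintegral_meanL_comp hX_meas hX_law hL]
  congr 2
  refine Finset.sum_congr rfl fun i _ => ?_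
  rw [lintegral_finsetSum _ fun j _ => h3 i j]
  refine Finset.sum_congr rfl fun j hj => ?_
  exact lintegral_interH_pair hX_meas hX_indep hX_law hH
    (fun h => (Finset.mem_erase.1 hj).1 (Fin.ext h.symm)) _ _

/-- Every profile induces a random probability measure. -/
lemma exists_isInducedBy (hX_meas : ∀ i, Measurable (X i)) {N : ℕ} (hN : 1 ≤ N)
    (κ : Fin N → Strategy 𝒳 𝒴) : ∃ γ : RandomPM Ω (𝒳 × 𝒴), IsInducedBy P X κ γ := by
  refine ⟨⟨fun ω => ⟨average fun i : Fin N => (Measure.dirac (X i ω)).prod ((κ i).1 (X i ω)),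
    isProbabilityMeasure_average hN _⟩, ?_⟩, Eventually.of_forall fun ω => rfl⟩
  refine Measurable.subtype_mk (Measure.measurable_of_measurable_coe _ fun s hs => ?_)
  simp only [average, Measure.smul_apply, Measure.finsetSum_apply, smul_eq_mul]
  refine (Finset.measurable_sum _ fun i _ => ?_).const_mul _
  have := (Kernel.measurable_coe (Kernel.id ×ₖ (κ i).1) hs).comp (hX_meas i)
  simpa [Function.comp_def, Kernel.prod_apply, Kernel.id_apply] using this

/-- The diagonal is `μ ⊗ μ`-null because its sections are singletons. Atomlessness enters the
argument only here. -/
lemma ae_injective [IsProbabilityMeasure P] [IsProbabilityMeasure μ] (hμ : ∀ x, μ {x} = 0)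
    [MeasurableSingletonClass 𝒳] [MeasurableEq 𝒳]
    (hX_meas : ∀ i, Measurable (X i)) (hX_indep : iIndepFun X P)
    (hX_law : ∀ i, P.map (X i) = μ) : ∀ᵐ ω ∂P, Function.Injective fun i => X i ω := by
  have : ∀ i j : ℕ, ∀ᵐ ω ∂P, i ≠ j → X i ω ≠ X j ω := by
    intro i j
    by_cases hij : i = j
    · simp [hij]
    · have hdiag : MeasurableSet {p : 𝒳 × 𝒳 | p.1 = p.2} := 
        measurableSet_eq_fun measurable_fst measurable_snd
      have h0 : (μ.prod μ) {p : 𝒳 × 𝒳 | p.1 = p.2} = 0 := by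
        rw [Measure.prod_apply hdiag]
        have : ∀ x, Prod.mk x ⁻¹' {p : 𝒳 × 𝒳 | p.1 = p.2} = {x} := fun x => by
          ext y; simp [eq_comm]
        simp [this, hμ]
      rw [← map_pair_eq_prod hX_meas hX_indep hX_law hij,
        Measure.map_apply ((hX_meas i).prodMk (hX_meas j)) hdiag] at h0
      filter_upwards [measure_eq_zero_iff_ae_notMem.1 h0] with ω hω _ using hω
  filter_upwards [ae_all_iff.2 fun i => ae_all_iff.2 (this i)] with ω hω i j hij
  by_contra hne
  exact hω i j hne hij

/-- Two profiles inducing the same random measure define the same plans. -/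
lemma compProd_eq_of_isInducedBy [IsProbabilityMeasure P] [IsProbabilityMeasure μ]
    (hμ : ∀ x, μ {x} = 0)
    [MeasurableSingletonClass 𝒳] [MeasurableEq 𝒳]
    (hX_meas : ∀ i, Measurable (X i)) (hX_indep : iIndepFun X P)
    (hX_law : ∀ i, P.map (X i) = μ) {N : ℕ} (hN : 1 ≤ N) {κ κ' : Fin N → Strategy 𝒳 𝒴}
    {γ : RandomPM Ω (𝒳 × 𝒴)} (h : IsInducedBy P X κ γ) (h' : IsInducedBy P X κ' γ) (i : Fin N) :
    μ ⊗ₘ (κ i).1 = μ ⊗ₘ (κ' i).1 := by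
  have hω : ∀ᵐ ω ∂P, (κ i).1 (X i ω) = (κ' i).1 (X i ω) := by
    filter_upwards [h, h', ae_injective hμ hX_meas hX_indep hX_law] with ω h1 h2 hinj
    -- Since the types are distinct, the slice over `X i ω` isolates the summand of player `i`.
    have hval : ∀ (η : Fin N → Strategy 𝒳 𝒴) (s : Set 𝒴), MeasurableSet s →
        ((N : ℝ≥0∞)⁻¹ • ∑ j : Fin N, (Measure.dirac (X j ω)).prod ((η j).1 (X j ω)))
          ({X i ω} ×ˢ s) = (N : ℝ≥0∞)⁻¹ * (η i).1 (X i ω) s := by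
      intro η s hs
      rw [Measure.smul_apply, Measure.finsetSum_apply, Finset.sum_eq_single i]
      · simp
      · intro j _ hj
        rw [Measure.prod_prod, Measure.dirac_apply' _ (measurableSet_singleton _)]
        have : X j ω ≠ X i ω := fun hji => hj (Fin.ext (hinj hji))
        simp [this]
      · simp
    ext s hs
    have := congrArg (fun m : Measure (𝒳 × 𝒴) => m ({X i ω} ×ˢ s)) (h1.symm.trans h2)
    simp only [hval κ s hs, hval κ' s hs] at this
    exact (ENNReal.mul_right_inj (by simp) (by simp; omega)).1 this
  ext s hs
  have h1 : ∀ η : Strategy 𝒳 𝒴, (μ ⊗ₘ η.1) s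
      = ∫⁻ ω, ∫⁻ y, s.indicator 1 (X i ω, y) ∂(η.1 (X i ω)) ∂P := fun η => by
    rw [lintegral_section_comp hX_meas hX_law (measurable_one.indicator hs),
      lintegral_indicator_one hs]
  rw [h1, h1]
  exact lintegral_congr_ae (hω.mono fun ω h => by simp only [h])

/-- The infimum in the definition is over a constant: all inducing profiles define the same plans,
hence the same second marginals and the same potential. -/
lemma openLoopPotential_eq [IsProbabilityMeasure P] [IsProbabilityMeasure μ] (hμ : ∀ x, μ {x} = 0)
    [MeasurableSingletonClass 𝒳] [MeasurableEq 𝒳]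
    (hX_meas : ∀ i, Measurable (X i)) (hX_indep : iIndepFun X P)
    (hX_law : ∀ i, P.map (X i) = μ) {c : 𝒳 × 𝒴 → ℝ≥0∞} {L : 𝒴 → ℝ≥0∞} {H : 𝒴 × 𝒴 → ℝ≥0∞}
    (hc : Measurable c) (hL : Measurable L) (hH : Measurable H) {N : ℕ} (hN : 1 ≤ N)
    {κ : Fin N → Strategy 𝒳 𝒴} {γ : RandomPM Ω (𝒳 × 𝒴)} (hκ : IsInducedBy P X κ γ) :
    openLoopPotential c L H P X N γ = profilePotential c L H μ κ := by
  refine le_antisymm ((iInf₂_le κ hκ).trans_eq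
    (lintegral_potential_eq hX_meas hX_indep hX_law hc hL hH hκ)) (le_iInf₂ fun κ' hκ' => ?_)
  rw [lintegral_potential_eq hX_meas hX_indep hX_law hc hL hH hκ']
  have h1 := compProd_eq_of_isInducedBy hμ hX_meas hX_indep hX_law hN hκ hκ'
  have h2 : ∀ i, (κ i).1 ∘ₘ μ = (κ' i).1 ∘ₘ μ := fun i => by
    rw [← Measure.snd_compProd, h1 i, Measure.snd_compProd]
  simp only [profilePotential, h1, h2, le_refl]

end Game

/-! ### The potential and Nash equilibria -/

section Potential

/-- The algebra of a potential game: row `i` and column `i` of the interaction matrix coincide by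
symmetry, which produces the factor `2`. -/
lemma potential_sum_eq {N : ℕ} (a : Fin N → ℝ≥0∞) (h : Fin N → Fin N → ℝ≥0∞)
    (hsymm : ∀ i j, h i j = h j i) (i : Fin N) :
    (N : ℝ≥0∞)⁻¹ * ∑ j, a j + ((N : ℝ≥0∞) ^ 2)⁻¹ * ∑ j, ∑ k ∈ Finset.univ.erase j, h j k
      = (N : ℝ≥0∞)⁻¹ * (a i + 2 / N * ∑ j ∈ Finset.univ.erase i, h i j)
        + ((N : ℝ≥0∞)⁻¹ * ∑ j ∈ Finset.univ.erase i, a j + ((N : ℝ≥0∞) ^ 2)⁻¹ *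
          ∑ j ∈ Finset.univ.erase i, ∑ k ∈ (Finset.univ.erase j).erase i, h j k) := by
  have h1 : ∑ j ∈ Finset.univ.erase i, ∑ k ∈ Finset.univ.erase j, h j k
      = ∑ j ∈ Finset.univ.erase i, h i j
        + ∑ j ∈ Finset.univ.erase i, ∑ k ∈ (Finset.univ.erase j).erase i, h j k := by
    rw [← Finset.sum_add_distrib]
    refine Finset.sum_congr rfl fun j hj => ?_
    rw [hsymm i j, Finset.add_sum_erase]
    exact Finset.mem_erase.2 ⟨(Finset.ne_of_mem_erase hj).symm, Finset.mem_univ _⟩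
  rw [← Finset.add_sum_erase _ a (Finset.mem_univ i),
    ← Finset.add_sum_erase _ (fun j => ∑ k ∈ Finset.univ.erase j, h j k) (Finset.mem_univ i), h1,
    div_eq_mul_inv, ENNReal.inv_pow]
  ring

variable {𝒳 𝒴 : Type*} [MeasurableSpace 𝒳] [MeasurableSpace 𝒴]
  {Ω : Type*} [MeasurableSpace Ω] {P : Measure Ω} [IsProbabilityMeasure P]
  {X : ℕ → Ω → 𝒳}

/-- The part of the potential which does not depend on the strategy of player `i`. -/
def restPotential (c : 𝒳 × 𝒴 → ℝ≥0∞) (L : 𝒴 → ℝ≥0∞) (H : 𝒴 × 𝒴 → ℝ≥0∞) (μ : Measure 𝒳)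
    {N : ℕ} (κ : Fin N → Strategy 𝒳 𝒴) (i : Fin N) : ℝ≥0∞ :=
  (N : ℝ≥0∞)⁻¹ * ∑ j ∈ Finset.univ.erase i,
      (∫⁻ p, c p ∂(μ ⊗ₘ (κ j).1) + meanL L ((κ j).1 ∘ₘ μ))
    + ((N : ℝ≥0∞) ^ 2)⁻¹ * ∑ j ∈ Finset.univ.erase i, ∑ k ∈ (Finset.univ.erase j).erase i,
        interH H ((κ j).1 ∘ₘ μ) ((κ k).1 ∘ₘ μ)

lemma restPotential_update (c : 𝒳 × 𝒴 → ℝ≥0∞) (L : 𝒴 → ℝ≥0∞) (H : 𝒴 × 𝒴 → ℝ≥0∞)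
    (μ : Measure 𝒳) {N : ℕ} (κ : Fin N → Strategy 𝒳 𝒴) (i : Fin N) (κ' : Strategy 𝒳 𝒴) :
    restPotential c L H μ (Function.update κ i κ') i = restPotential c L H μ κ i := by
  unfold restPotential
  congr 2
  · refine Finset.sum_congr rfl fun j hj => ?_
    rw [Function.update_of_ne (Finset.ne_of_mem_erase hj)]
  · refine Finset.sum_congr rfl fun j hj => Finset.sum_congr rfl fun k hk => ?_
    rw [Function.update_of_ne (Finset.ne_of_mem_erase hj),
      Function.update_of_ne (Finset.ne_of_mem_erase hk)]

variable {μ : Measure 𝒳} [IsProbabilityMeasure μ]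

lemma profilePotential_eq_add (hX_meas : ∀ i, Measurable (X i)) (hX_indep : iIndepFun X P)
    (hX_law : ∀ i, P.map (X i) = μ) {c : 𝒳 × 𝒴 → ℝ≥0∞} {L : 𝒴 → ℝ≥0∞} {H : 𝒴 × 𝒴 → ℝ≥0∞}
    (hc : Measurable c) (hL : Measurable L) (hH : Measurable H)
    (hH_symm : ∀ y y', H (y, y') = H (y', y)) {N : ℕ} (κ : Fin N → Strategy 𝒳 𝒴) (i : Fin N) :
    profilePotential c L H μ κ
      = (N : ℝ≥0∞)⁻¹ * playerCost c L H P X i κ + restPotential c L H μ κ i := by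
  rw [playerCost_eq hX_meas hX_indep hX_law hc hL hH]
  exact potential_sum_eq _ (fun j k => interH H ((κ j).1 ∘ₘ μ) ((κ k).1 ∘ₘ μ))
    (fun j k => interH_comm hH hH_symm _ _) i

/-- Profiles inducing a minimizer of finite potential are Nash equilibria. -/
lemma isOpenLoopNash_of_isMinOn (hμ : ∀ x, μ {x} = 0) [MeasurableSingletonClass 𝒳] [MeasurableEq 𝒳]
    (hX_meas : ∀ i, Measurable (X i)) (hX_indep : iIndepFun X P)
    (hX_law : ∀ i, P.map (X i) = μ) {c : 𝒳 × 𝒴 → ℝ≥0∞} {L : 𝒴 → ℝ≥0∞} {H : 𝒴 × 𝒴 → ℝ≥0∞}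
    (hc : Measurable c) (hL : Measurable L) (hH : Measurable H)
    (hH_symm : ∀ y y', H (y, y') = H (y', y)) {N : ℕ} (hN : 1 ≤ N) {γ : RandomPM Ω (𝒳 × 𝒴)}
    (hmin : IsMinOn (openLoopPotential c L H P X N) Set.univ γ)
    (hfin : openLoopPotential c L H P X N γ < ∞) {κ : Fin N → Strategy 𝒳 𝒴}
    (hκ : IsInducedBy P X κ γ) : IsOpenLoopNash c L H P X κ := by
  intro i κ'
  obtain ⟨γ', hγ'⟩ := exists_isInducedBy (P := P) hX_meas hN (Function.update κ i κ')
  have hle : openLoopPotential c L H P X N γ ≤ openLoopPotential c L H P X N γ' :=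
    hmin (Set.mem_univ γ')
  rw [openLoopPotential_eq hμ hX_meas hX_indep hX_law hc hL hH hN hκ] at hle hfin
  rw [openLoopPotential_eq hμ hX_meas hX_indep hX_law hc hL hH hN hγ',
    profilePotential_eq_add hX_meas hX_indep hX_law hc hL hH hH_symm _ i,
    profilePotential_eq_add hX_meas hX_indep hX_law hc hL hH hH_symm _ i,
    restPotential_update] at hle
  rw [profilePotential_eq_add hX_meas hX_indep hX_law hc hL hH hH_symm _ i] at hfin
  -- Finiteness of the potential is needed to cancel the common term in `ℝ≥0∞`.
  have hrest : restPotential c L H μ κ i ≠ ∞ := (ENNReal.add_lt_top.1 hfin).2.ne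
  exact (ENNReal.mul_le_mul_iff_right (by simp) (by simp; omega)).1
    ((ENNReal.add_le_add_iff_right hrest).1 hle)

/-- Plans disintegrate. -/
lemma exists_strategy_of_mem_plans [StandardBorelSpace 𝒴] {μ : ProbabilityMeasure 𝒳}
    {γ : ProbabilityMeasure (𝒳 × 𝒴)}
    (hγ : γ ∈ plans 𝒴 μ) : ∃ κ : Strategy 𝒳 𝒴, (γ : Measure (𝒳 × 𝒴)) = (μ : Measure 𝒳) ⊗ₘ κ.1 := by
  have : Nonempty 𝒴 := (γ.nonempty).map Prod.snd
  refine ⟨⟨(γ : Measure (𝒳 × 𝒴)).condKernel, inferInstance⟩, ?_⟩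
  have h : (γ : Measure (𝒳 × 𝒴)).fst = μ := hγ
  rw [← h, Measure.disintegrate]

lemma energy_eq {c : 𝒳 × 𝒴 → ℝ≥0∞} {L : 𝒴 → ℝ≥0∞} {H : 𝒴 × 𝒴 → ℝ≥0∞}
    {μ : ProbabilityMeasure 𝒳} {γ : ProbabilityMeasure (𝒳 × 𝒴)} (hγ : γ ∈ plans 𝒴 μ) :
    energy c L H μ γ = ∫⁻ p, c p ∂(γ : Measure (𝒳 × 𝒴)) + meanL L (γ : Measure (𝒳 × 𝒴)).snd
      + interH H (γ : Measure (𝒳 × 𝒴)).snd (γ : Measure (𝒳 × 𝒴)).snd := by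
  rw [energy, if_pos hγ]; rfl

/-- The potential of a constant profile is at most the energy of the corresponding plan. -/
lemma profilePotential_const_le (c : 𝒳 × 𝒴 → ℝ≥0∞) (L : 𝒴 → ℝ≥0∞) (H : 𝒴 × 𝒴 → ℝ≥0∞)
    {N : ℕ} (hN : 1 ≤ N) {μ : ProbabilityMeasure 𝒳} {γ : ProbabilityMeasure (𝒳 × 𝒴)}
    (hγ : γ ∈ plans 𝒴 μ) {κ : Strategy 𝒳 𝒴}
    (hκ : (γ : Measure (𝒳 × 𝒴)) = (μ : Measure 𝒳) ⊗ₘ κ.1) :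
    profilePotential c L H μ (fun _ : Fin N => κ) ≤ energy c L H μ γ := by
  rw [energy_eq hγ, hκ, Measure.snd_compProd, profilePotential, natCast_inv_mul_sum_const hN]
  gcongr
  set h := interH H (κ.1 ∘ₘ (μ : Measure 𝒳)) (κ.1 ∘ₘ (μ : Measure 𝒳))
  -- Adding the nonnegative diagonal terms gives exactly `N²` copies of `h`.
  calc ((N : ℝ≥0∞) ^ 2)⁻¹ * ∑ i : Fin N, ∑ j ∈ Finset.univ.erase i, h
      ≤ ((N : ℝ≥0∞) ^ 2)⁻¹ * ∑ i : Fin N, ∑ j : Fin N, h := by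
        gcongr
        exact Finset.subset_univ _
    _ = (N : ℝ≥0∞)⁻¹ * ∑ i : Fin N, (N : ℝ≥0∞)⁻¹ * ∑ j : Fin N, h := by
        rw [← Finset.mul_sum, ← mul_assoc, ENNReal.inv_pow, sq]
    _ = h := by simp_rw [natCast_inv_mul_sum_const hN]

end Potential

/-! ### Narrow convergence of random probability measures -/

section Narrow

variable {Ω Z : Type*} [MeasurableSpace Ω] {P : Measure Ω}

/-- Test functions localized on an event; they detect whether a narrow limit is deterministic. -/
lemma isRandomBCF_indicator_mul [IsProbabilityMeasure P] [TopologicalSpace Z] [Nonempty Z]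
    {A : Set Ω}
    (hA : MeasurableSet A)
    (g : Z →ᵇ ℝ) : IsRandomBCF P fun ω z => A.indicator 1 ω * g z where
  ae_boundedContinuous := Eventually.of_forall fun ω => ⟨by fun_prop, ‖g‖, fun z => by
    rw [abs_mul]
    refine (mul_le_of_le_one_left (abs_nonneg _) ?_).trans (g.norm_coe_le_norm z)
    by_cases h : ω ∈ A <;> simp [h]⟩
  measurable_left := fun z => (measurable_one.indicator hA).mul_const _
  integrable_norm := by
    have : (fun ω => ⨆ z, |A.indicator (1 : Ω → ℝ) ω * g z|)
        = A.indicator fun _ => ⨆ z, |g z| := by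
      ext ω
      by_cases h : ω ∈ A <;> simp [h]
    rw [this]
    exact (integrable_const _).indicator hA

variable [MeasurableSpace Z]

/-- A random probability measure as a kernel. -/
def RandomPM.kernel (γ : RandomPM Ω Z) : Kernel Ω Z :=
  ⟨fun ω => (γ.1 ω : Measure Z), measurable_subtype_coe.comp γ.2⟩

instance (γ : RandomPM Ω Z) : IsMarkovKernel γ.kernel :=
  ⟨fun ω => inferInstanceAs (IsProbabilityMeasure (γ.1 ω : Measure Z))⟩

lemma RandomPM.kernel_apply (γ : RandomPM Ω Z) (ω : Ω) : γ.kernel ω = (γ.1 ω : Measure Z) := rfl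

/-- The intensity of a random probability measure. -/
def RandomPM.intensity (P : Measure Ω) [IsProbabilityMeasure P] (γ : RandomPM Ω Z) :
    ProbabilityMeasure Z :=
  ⟨γ.kernel ∘ₘ P, inferInstance⟩

variable [TopologicalSpace Z]

lemma narrowTendsto_iff {γ : ℕ → RandomPM Ω Z} {γ₀ : RandomPM Ω Z} :
    NarrowTendsto P γ γ₀ ↔ ∀ f : Ω → Z → ℝ, IsRandomBCF P f →
      Tendsto (fun n => ∫ ω, ∫ z, f ω z ∂((γ n).1 ω : Measure Z) ∂P) atTop
        (𝓝 (∫ ω, ∫ z, f ω z ∂(γ₀.1 ω : Measure Z) ∂P)) := by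
  unfold NarrowTendsto narrowTopology
  rw [nhds_iInf, tendsto_iInf]
  simp only [nhds_induced, tendsto_comap_iff, Function.comp_def, Subtype.forall]

lemma measurable_integral_bcf [OpensMeasurableSpace Z] (γ : RandomPM Ω Z) (g : Z →ᵇ ℝ) :
    Measurable fun ω => ∫ z, g z ∂(γ.1 ω : Measure Z) := by
  have h : StronglyMeasurable fun p : Ω × Z => g p.2 :=
    (g.continuous.measurable.comp measurable_snd).stronglyMeasurable
  exact (h.integral_kernel_prod_right' (κ := γ.kernel)).measurable

lemma abs_integral_bcf_le [OpensMeasurableSpace Z] (ν : Measure Z) [IsProbabilityMeasure ν]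
    (g : Z →ᵇ ℝ) : |∫ z, g z ∂ν| ≤ ‖g‖ := by
  simpa using g.norm_integral_le_norm ν

/-- Setting `f` to zero on a measurable null set makes it continuous in `z` for every `ω`; together
with measurability in `ω` this gives joint measurability. -/
lemma aestronglyMeasurable_integral_randomBCF [PolishSpace Z] [BorelSpace Z] {f : Ω → Z → ℝ}
    (hf : IsRandomBCF P f) (γ : RandomPM Ω Z) :
    AEStronglyMeasurable (fun ω => ∫ z, f ω z ∂(γ.1 ω : Measure Z)) P := by
  classical
  obtain ⟨A, hAsub, hA, hA0⟩ := exists_measurable_superset_of_null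
    (ae_iff.1 hf.ae_boundedContinuous)
  let f' : Z → Ω → ℝ := fun z => Aᶜ.indicator fun ω => f ω z
  have hcont : ∀ ω, Continuous fun z => f' z ω := by
    intro ω
    by_cases hω : ω ∈ A
    · simpa [f', hω] using continuous_const
    · have : (fun z => f' z ω) = f ω := by ext z; simp [f', hω]
      rw [this]
      by_contra hc
      exact hω (hAsub fun h => hc h.1)
  have hmeas := measurable_uncurry_of_continuous_of_measurable hcont
    fun z => (hf.measurable_left z).indicator hA.compl
  have h' : StronglyMeasurable fun p : Ω × Z => f' p.2 p.1 :=
    (hmeas.comp measurable_swap).stronglyMeasurable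
  refine ⟨_, h'.integral_kernel_prod_right' (κ := γ.kernel), ?_⟩
  filter_upwards [measure_eq_zero_iff_ae_notMem.1 hA0] with ω hω
  simp [f', hω, RandomPM.kernel_apply]

/-- Almost sure weak convergence implies narrow convergence. -/
lemma narrowTendsto_of_ae_tendsto [PolishSpace Z] [BorelSpace Z] {γ : ℕ → RandomPM Ω Z}
    {γ₀ : RandomPM Ω Z} (h : ∀ᵐ ω ∂P, Tendsto (fun n => (γ n).1 ω) atTop (𝓝 (γ₀.1 ω))) :
    NarrowTendsto P γ γ₀ := by
  rw [narrowTendsto_iff]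
  intro f hf
  refine tendsto_integral_of_dominated_convergence (fun ω => ⨆ z, |f ω z|)
    (fun n => aestronglyMeasurable_integral_randomBCF hf _) hf.integrable_norm (fun n => ?_) ?_
  · filter_upwards [hf.ae_boundedContinuous] with ω ⟨hc, C, hC⟩
    have hbdd : BddAbove (Set.range fun z => |f ω z|) := ⟨C, by rintro _ ⟨z, rfl⟩; exact hC z⟩
    refine (norm_integral_le_of_norm_le_const (μ := ((γ n).1 ω : Measure Z))
      (C := ⨆ z, |f ω z|) (Eventually.of_forall fun z => ?_)).trans ?_
    · exact le_ciSup hbdd z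
    · simp
  · filter_upwards [hf.ae_boundedContinuous, h] with ω ⟨hc, C, hC⟩ hω
    exact ProbabilityMeasure.tendsto_iff_forall_integral_tendsto.1 hω
      (BoundedContinuousFunction.ofNormedAddCommGroup (f ω) hc C hC)

lemma RandomPM.integral_intensity [IsProbabilityMeasure P] [OpensMeasurableSpace Z]
    (γ : RandomPM Ω Z) (g : Z →ᵇ ℝ) :
    ∫ z, g z ∂(γ.intensity P : Measure Z) = ∫ ω, ∫ z, g z ∂(γ.1 ω : Measure Z) ∂P := by
  have h : (γ.intensity P : Measure Z) = γ.kernel ∘ₘ P := rfl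
  rw [h, ← Measure.snd_compProd, Measure.snd, integral_map measurable_snd.aemeasurable
    g.continuous.measurable.aestronglyMeasurable]
  exact Measure.integral_compProd
    ((g.integrable ((P ⊗ₘ γ.kernel).snd)).comp_measurable measurable_snd)

lemma memLp_integral_sub [IsProbabilityMeasure P] [OpensMeasurableSpace Z] (γ : RandomPM Ω Z)
    (g : Z →ᵇ ℝ) (a : ℝ) : MemLp (fun ω => ∫ z, g z ∂(γ.1 ω : Measure Z) - a) 2 P :=
  (MemLp.of_bound (measurable_integral_bcf γ g).aestronglyMeasurable ‖g‖
    (Eventually.of_forall fun _ => abs_integral_bcf_le _ g)).sub (memLp_const a)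

end Narrow

/-! ### The law of large numbers for induced random measures -/

section LLN

variable {𝒳 𝒴 Ω : Type*} [TopologicalSpace 𝒳] [PolishSpace 𝒳] [MeasurableSpace 𝒳] [BorelSpace 𝒳]
    [TopologicalSpace 𝒴] [PolishSpace 𝒴] [MeasurableSpace 𝒴] [BorelSpace 𝒴]
    [MeasurableSpace Ω] {P : Measure Ω} [IsProbabilityMeasure P]
    {μ : Measure 𝒳} [IsProbabilityMeasure μ]
    {X : ℕ → Ω → 𝒳}

lemma integral_average {Z : Type*} [MeasurableSpace Z] {N : ℕ} (m : Fin N → Measure Z)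
    {g : Z → ℝ} (hg : ∀ i, Integrable g (m i)) :
    ∫ z, g z ∂(average m) = (N : ℝ)⁻¹ * ∑ i, ∫ z, g z ∂(m i) := by
  rw [average, integral_smul_measure, integral_finsetSum_measure fun i _ => hg i]
  simp

/-- The fluctuations of an induced random measure around its mean are of order `N^{-1/2}`. -/
lemma integral_sq_sub_le (hX_meas : ∀ i, Measurable (X i)) (hX_indep : iIndepFun X P)
    (hX_law : ∀ i, P.map (X i) = μ) {N : ℕ} (hN : 1 ≤ N) {κ : Fin N → Strategy 𝒳 𝒴}
    {γ : RandomPM Ω (𝒳 × 𝒴)} (hκ : IsInducedBy P X κ γ) (g : 𝒳 × 𝒴 →ᵇ ℝ) :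
    ∫ ω, (∫ z, g z ∂(γ.1 ω : Measure (𝒳 × 𝒴))
      - ∫ z, g z ∂(average fun i => μ ⊗ₘ (κ i).1)) ^ 2 ∂P ≤ ‖g‖ ^ 2 / N := by
  -- The random integral is the mean of the independent bounded variables `G i (X i)`, whose
  -- expectations are the integrals of `g` against the plans.
  let G : Fin N → 𝒳 → ℝ := fun i x => ∫ y, g (x, y) ∂((κ i).1 x)
  have hG : ∀ i, Measurable (G i) := fun i =>
    (g.continuous.measurable.stronglyMeasurable.integral_kernel_prod_right'
      (κ := (κ i).1)).measurable
  have hGb : ∀ i x, |G i x| ≤ ‖g‖ := fun i x => by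
    refine (norm_integral_le_of_norm_le_const (C := ‖g‖)
      (Eventually.of_forall fun y => g.norm_coe_le_norm (x, y))).trans ?_
    simp
  let Y : Fin N → Ω → ℝ := fun i ω => G i (X i ω)
  have hY : ∀ i, Measurable (Y i) := fun i => (hG i).comp (hX_meas i)
  have hYm : ∀ i, MemLp (Y i) 2 P := fun i =>
    MemLp.of_bound (hY i).aestronglyMeasurable ‖g‖ (Eventually.of_forall fun ω => hGb i _)
  have hYE : ∀ i, ∫ ω, Y i ω ∂P = ∫ z, g z ∂(μ ⊗ₘ (κ i).1) := fun i => by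
    rw [Measure.integral_compProd (g.integrable _), ← hX_law i,
      integral_map (hX_meas i).aemeasurable (hG i).aestronglyMeasurable]
  have hS : ∀ᵐ ω ∂P, ∫ z, g z ∂(γ.1 ω : Measure (𝒳 × 𝒴)) = (N : ℝ)⁻¹ * ∑ i, Y i ω := by
    filter_upwards [hκ] with ω hω
    have := integral_average (fun i : Fin N => (Measure.dirac (X i ω)).prod ((κ i).1 (X i ω)))
      (g := g) (fun i => g.integrable _)
    rw [hω, ← average, this]
    congr 1
    refine Finset.sum_congr rfl fun i _ => ?_
    rw [integral_prod _ (g.integrable _), integral_dirac]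
  have hmean : ∫ z, g z ∂(average fun i => μ ⊗ₘ (κ i).1)
      = ∫ ω, (N : ℝ)⁻¹ * ∑ i, Y i ω ∂P := by
    rw [integral_average _ fun i => g.integrable _, integral_const_mul,
      integral_finsetSum _ fun i _ => (hYm i).integrable (by norm_num)]
    simp_rw [hYE]
  have hNpos : (0 : ℝ) < N := by exact_mod_cast hN
  calc ∫ ω, (∫ z, g z ∂(γ.1 ω : Measure (𝒳 × 𝒴))
        - ∫ z, g z ∂(average fun i => μ ⊗ₘ (κ i).1)) ^ 2 ∂P
      = Var[fun ω => (N : ℝ)⁻¹ * ∑ i, Y i ω; P] := by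
        rw [variance_eq_integral
            ((Finset.measurable_sum _ fun i _ => hY i).const_mul _).aemeasurable,
          ← hmean]
        exact integral_congr_ae (hS.mono fun ω hω => by simp only [hω])
    _ = (N : ℝ)⁻¹ ^ 2 * ∑ i, Var[Y i; P] := by
        rw [variance_const_mul, ← IndepFun.variance_sum (fun i _ => hYm i)]
        · congr 2
          ext ω
          simp
        · intro i _ j _ hij
          exact (hX_indep.indepFun fun h => hij (Fin.ext h)).comp (hG i) (hG j)
    _ ≤ (N : ℝ)⁻¹ ^ 2 * ∑ _i : Fin N, ‖g‖ ^ 2 := by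
        gcongr with i
        -- A variable with values in `[-‖g‖, ‖g‖]` has variance at most the square of half the
        -- length of this interval.
        have := variance_le_sq_of_bounded (μ := P) (X := Y i) (a := -‖g‖) (b := ‖g‖)
          (Eventually.of_forall fun ω => abs_le.1 (hGb i _)) (hY i).aemeasurable
        refine this.trans_eq ?_
        ring
    _ = ‖g‖ ^ 2 / N := by
        simp
        field_simp

variable {N : ℕ → ℕ} {κ : ∀ k, Fin (N k) → Strategy 𝒳 𝒴} {γ : ℕ → RandomPM Ω (𝒳 × 𝒴)}
  {η : ℕ → ProbabilityMeasure (𝒳 × 𝒴)}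

/-- If the number of players grows fast enough, the induced random measures almost surely have the
same weak limits as their means. -/
lemma ae_tendsto_of_summable (hX_meas : ∀ i, Measurable (X i)) (hX_indep : iIndepFun X P)
    (hX_law : ∀ i, P.map (X i) = μ) (hN : ∀ k, 1 ≤ N k) (hNsum : Summable fun k => (N k : ℝ)⁻¹)
    (hκ : ∀ k, IsInducedBy P X (κ k) (γ k))
    (hη : ∀ k, (η k : Measure (𝒳 × 𝒴)) = average fun i => μ ⊗ₘ (κ k i).1)
    {γ₀ : ProbabilityMeasure (𝒳 × 𝒴)} (hlim : Tendsto η atTop (𝓝 γ₀)) :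
    ∀ᵐ ω ∂P, Tendsto (fun k => (γ k).1 ω) atTop (𝓝 γ₀) := by
  obtain ⟨g, hg⟩ := exists_convergenceDetermining (Z := 𝒳 × 𝒴)
  have key : ∀ j, ∀ᵐ ω ∂P, Tendsto (fun k => ∫ z, g j z ∂((γ k).1 ω : Measure (𝒳 × 𝒴))) atTop
      (𝓝 (∫ z, g j z ∂(γ₀ : Measure (𝒳 × 𝒴)))) := by
    intro j
    let D : ℕ → Ω → ℝ := fun k ω => ∫ z, g j z ∂((γ k).1 ω : Measure (𝒳 × 𝒴))
      - ∫ z, g j z ∂(η k : Measure (𝒳 × 𝒴))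
    have hDm : ∀ k, MemLp (D k) 2 P := fun k => memLp_integral_sub _ _ _
    have hD2 : ∀ k, ∫⁻ ω, ENNReal.ofReal (D k ω ^ 2) ∂P
        ≤ ENNReal.ofReal (‖g j‖ ^ 2 * (N k : ℝ)⁻¹) := by
      intro k
      rw [← ofReal_integral_eq_lintegral_ofReal (hDm k).integrable_sq
        (Eventually.of_forall fun ω => sq_nonneg _), ← div_eq_mul_inv]
      refine ENNReal.ofReal_le_ofReal ?_
      simp only [D, hη]
      exact integral_sq_sub_le hX_meas hX_indep hX_law (hN k) (hκ k) (g j)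
    have hDmeas : ∀ k, Measurable (D k) := fun k =>
      (measurable_integral_bcf (γ k) (g j)).sub_const _
    -- The second moments are summable, so almost surely the series of squares is finite and its
    -- terms tend to zero. Countably many test functions then need only one null set.
    have hfin : ∫⁻ ω, ∑' k, ENNReal.ofReal (D k ω ^ 2) ∂P ≠ ∞ := by
      rw [lintegral_tsum fun k => ((hDmeas k).pow_const 2).ennreal_ofReal.aemeasurable]
      refine ((ENNReal.tsum_le_tsum hD2).trans_lt ?_).ne
      rw [← ENNReal.ofReal_tsum_of_nonneg (fun k => by positivity) (hNsum.mul_left _)]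
      exact ENNReal.ofReal_lt_top
    filter_upwards [ae_lt_top (Measurable.tsum fun k =>
      ((hDmeas k).pow_const 2).ennreal_ofReal) hfin] with ω hω
    have h1 : Tendsto (fun k => ENNReal.ofReal (D k ω ^ 2)) atTop (𝓝 0) :=
      ENNReal.tendsto_atTop_zero_of_tsum_ne_top hω.ne
    have h2 : Tendsto (fun k => D k ω ^ 2) atTop (𝓝 0) := by
      have := (ENNReal.tendsto_toReal ENNReal.zero_ne_top).comp h1
      simpa [Function.comp_def, ENNReal.toReal_ofReal (sq_nonneg _)] using this
    have h3 : Tendsto (fun k => D k ω) atTop (𝓝 0) := by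
      rw [tendsto_zero_iff_abs_tendsto_zero]
      have := (Real.continuous_sqrt.tendsto 0).comp h2
      simpa [Function.comp_def, Real.sqrt_sq_eq_abs] using this
    have h4 := h3.add (ProbabilityMeasure.tendsto_iff_forall_integral_tendsto.1 hlim (g j))
    simpa [D] using h4
  filter_upwards [ae_all_iff.2 key] with ω hω
  exact hg _ _ hω

/-- A narrow limit of induced random measures is almost surely deterministic, and the means of
the random measures converge weakly to it. -/
lemma exists_const_limit (hX_meas : ∀ i, Measurable (X i)) (hX_indep : iIndepFun X P)
    (hX_law : ∀ i, P.map (X i) = μ) (hN : ∀ k, 1 ≤ N k) (hNlim : Tendsto N atTop atTop)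
    (hκ : ∀ k, IsInducedBy P X (κ k) (γ k))
    (hη : ∀ k, (η k : Measure (𝒳 × 𝒴)) = average fun i => μ ⊗ₘ (κ k i).1)
    {γlim : RandomPM Ω (𝒳 × 𝒴)} (hlim : NarrowTendsto P γ γlim) :
    ∃ γ₀ : ProbabilityMeasure (𝒳 × 𝒴), (∀ᵐ ω ∂P, γlim.1 ω = γ₀) ∧ Tendsto η atTop (𝓝 γ₀) := by
  rw [narrowTendsto_iff] at hlim
  have hne : Nonempty (𝒳 × 𝒴) := (η 0).nonempty
  -- On every event the random integral may be replaced by its mean. Comparison with `A = Ω` shows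
  -- that the limiting random integral has the same integral over each event as a constant.
  have key : ∀ (g : 𝒳 × 𝒴 →ᵇ ℝ) (A : Set Ω), MeasurableSet A →
      Tendsto (fun k => P.real A * ∫ z, g z ∂(η k : Measure (𝒳 × 𝒴))) atTop
        (𝓝 (∫ ω in A, ∫ z, g z ∂(γlim.1 ω : Measure (𝒳 × 𝒴)) ∂P)) := by
    intro g A hA
    have hset : ∀ γ : RandomPM Ω (𝒳 × 𝒴),
        ∫ ω, ∫ z, A.indicator 1 ω * g z ∂(γ.1 ω : Measure (𝒳 × 𝒴)) ∂P
        = ∫ ω in A, ∫ z, g z ∂(γ.1 ω : Measure (𝒳 × 𝒴)) ∂P := by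
      intro γ
      rw [← integral_indicator hA]
      refine integral_congr_ae (Eventually.of_forall fun ω => ?_)
      by_cases h : ω ∈ A <;> simp [h]
    have h1 := hlim _ (isRandomBCF_indicator_mul hA g)
    simp only [hset] at h1
    let D : ℕ → Ω → ℝ := fun k ω => ∫ z, g z ∂((γ k).1 ω : Measure (𝒳 × 𝒴))
      - ∫ z, g z ∂(η k : Measure (𝒳 × 𝒴))
    have hDm : ∀ k, MemLp (D k) 2 P := fun k => memLp_integral_sub _ _ _
    have hD : ∀ k, (∫ ω in A, D k ω ∂P) ^ 2 ≤ ‖g‖ ^ 2 / N k := by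
      intro k
      have hAm : MemLp (A.indicator (D k)) 2 P := (hDm k).indicator hA
      -- Nonnegativity of the variance serves as the Cauchy–Schwarz inequality.
      have hv := variance_nonneg (A.indicator (D k)) P
      rw [variance_eq_sub hAm, integral_indicator hA] at hv
      have h2 : ∫ ω, (A.indicator (D k) ^ 2) ω ∂P ≤ ∫ ω, D k ω ^ 2 ∂P := by
        refine integral_mono hAm.integrable_sq (hDm k).integrable_sq fun ω => ?_
        by_cases h : ω ∈ A <;> simp [h, sq_nonneg]
      have h3 : ∫ ω, D k ω ^ 2 ∂P ≤ ‖g‖ ^ 2 / N k := by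
        simp only [D, hη]
        exact integral_sq_sub_le hX_meas hX_indep hX_law (hN k) (hκ k) g
      linarith
    have hD0 : Tendsto (fun k => ∫ ω in A, D k ω ∂P) atTop (𝓝 0) := by
      have h2 : Tendsto (fun k => ‖g‖ ^ 2 / (N k : ℝ)) atTop (𝓝 0) :=
        (tendsto_const_div_atTop_nhds_zero_nat (‖g‖ ^ 2)).comp hNlim
      have h3 := squeeze_zero (fun k => sq_nonneg _) hD h2
      rw [tendsto_zero_iff_abs_tendsto_zero]
      have := (Real.continuous_sqrt.tendsto 0).comp h3
      simpa [Function.comp_def, Real.sqrt_sq_eq_abs] using this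
    have h4 := h1.sub hD0
    rw [sub_zero] at h4
    refine h4.congr fun k => ?_
    have hint : Integrable (fun ω => ∫ z, g z ∂((γ k).1 ω : Measure (𝒳 × 𝒴))) P := by
      simpa using (memLp_integral_sub (P := P) (γ k) g 0).integrable (by norm_num)
    rw [← integral_sub hint.integrableOn (((hDm k).integrable (by norm_num)).integrableOn)]
    simp [D]
  have huniv : ∀ g : 𝒳 × 𝒴 →ᵇ ℝ, Tendsto (fun k => ∫ z, g z ∂(η k : Measure (𝒳 × 𝒴))) atTop
      (𝓝 (∫ z, g z ∂(γlim.intensity P : Measure (𝒳 × 𝒴)))) := fun g => by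
    simpa [RandomPM.integral_intensity] using key g Set.univ MeasurableSet.univ
  refine ⟨γlim.intensity P, ?_, ProbabilityMeasure.tendsto_iff_forall_integral_tendsto.2 huniv⟩
  have hae : ∀ g : 𝒳 × 𝒴 →ᵇ ℝ, ∀ᵐ ω ∂P, ∫ z, g z ∂(γlim.1 ω : Measure (𝒳 × 𝒴))
      = ∫ z, g z ∂(γlim.intensity P : Measure (𝒳 × 𝒴)) := by
    intro g
    have hint : Integrable (fun ω => ∫ z, g z ∂(γlim.1 ω : Measure (𝒳 × 𝒴))) P := by
      simpa using (memLp_integral_sub (P := P) γlim g 0).integrable (by norm_num)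
    refine Integrable.ae_eq_of_forall_setIntegral_eq _ _ hint (integrable_const _) fun A hA _ => ?_
    rw [setIntegral_const, smul_eq_mul]
    exact tendsto_nhds_unique (key g A hA) ((huniv g).const_mul _)
  obtain ⟨g, hg⟩ := exists_convergenceDetermining (Z := 𝒳 × 𝒴)
  filter_upwards [ae_all_iff.2 fun j => hae (g j)] with ω hω
  -- A family determining convergence also separates measures: apply it to a constant sequence.
  have : Tendsto (fun _ : ℕ => γlim.1 ω) atTop (𝓝 (γlim.intensity P)) :=
    hg _ _ fun j => by rw [hω j]; exact tendsto_const_nhds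
  exact tendsto_nhds_unique tendsto_const_nhds this

end LLN

/-! ### Total costs -/

section TotalCost

variable {𝒳 𝒴 : Type*} [MeasurableSpace 𝒳] [MeasurableSpace 𝒴]
  {c : 𝒳 × 𝒴 → ℝ≥0∞} {L : 𝒴 → ℝ≥0∞} {H : 𝒴 × 𝒴 → ℝ≥0∞}

lemma meanL_snd (hL : Measurable L) (γ : Measure (𝒳 × 𝒴)) :
    meanL L γ.snd = ∫⁻ p, L p.2 ∂γ := lintegral_map hL measurable_snd

lemma interH_snd (hH : Measurable H) (γ γ' : Measure (𝒳 × 𝒴)) [IsFiniteMeasure γ]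
    [IsFiniteMeasure γ'] :
    interH H γ.snd γ'.snd = ∫⁻ r, H (r.1.2, r.2.2) ∂(γ.prod γ') := by
  rw [interH, Measure.snd, Measure.snd, Measure.map_prod_map _ _ measurable_snd measurable_snd,
    lintegral_map hH (by fun_prop)]
  rfl

/-- The double integral of `c(x, y) + L(y) + a H(y, y')`. -/
lemma lintegral_pair_cost (hc : Measurable c) (hL : Measurable L) (hH : Measurable H) (a : ℝ≥0∞)
    (γ γ' : Measure (𝒳 × 𝒴)) [IsProbabilityMeasure γ] [IsProbabilityMeasure γ'] :
    ∫⁻ r, (c r.1 + L r.1.2 + a * H (r.1.2, r.2.2)) ∂(γ.prod γ')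
      = ∫⁻ p, c p ∂γ + meanL L γ.snd + a * interH H γ.snd γ'.snd := by
  have h1 : Measurable fun r : (𝒳 × 𝒴) × (𝒳 × 𝒴) => c r.1 := hc.comp measurable_fst
  have h2 : Measurable fun r : (𝒳 × 𝒴) × (𝒳 × 𝒴) => L r.1.2 :=
    hL.comp (measurable_snd.comp measurable_fst)
  have h3 : Measurable fun r : (𝒳 × 𝒴) × (𝒳 × 𝒴) => H (r.1.2, r.2.2) := hH.comp (by fun_prop)
  have h12 : Measurable fun r : (𝒳 × 𝒴) × (𝒳 × 𝒴) => c r.1 + L r.1.2 := h1.add h2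
  rw [lintegral_add_left h12, lintegral_add_left h1, lintegral_const_mul _ h3,
    interH_snd hH, meanL_snd hL, lintegral_prod _ h1.aemeasurable, lintegral_prod _ h2.aemeasurable]
  simp

lemma measurable_socialCost (hc : Measurable c) (hL : Measurable L) (hH : Measurable H)
    (ν : Measure 𝒴) [SFinite ν] : Measurable fun p : 𝒳 × 𝒴 => socialCost c L H p.1 p.2 ν :=
  (hc.add (hL.comp measurable_snd)).add
    ((hH.lintegral_prod_right'.comp measurable_snd).const_mul _)

lemma lintegral_socialCost (hc : Measurable c) (hL : Measurable L) (hH : Measurable H)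
    (γ : Measure (𝒳 × 𝒴)) (ν : Measure 𝒴) [SFinite ν] :
    ∫⁻ p, socialCost c L H p.1 p.2 ν ∂γ
      = ∫⁻ p, c p ∂γ + meanL L γ.snd + 2 * interH H γ.snd ν := by
  have h2 : Measurable fun p : 𝒳 × 𝒴 => L p.2 := hL.comp measurable_snd
  have h12 : Measurable fun p : 𝒳 × 𝒴 => c p + L p.2 := hc.add h2
  have h3 : Measurable fun p : 𝒳 × 𝒴 => ∫⁻ y', H (p.2, y') ∂ν :=
    hH.lintegral_prod_right'.comp measurable_snd
  have h4 : interH H γ.snd ν = ∫⁻ p, ∫⁻ y', H (p.2, y') ∂ν ∂γ := by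
    rw [interH_eq_lintegral hH, Measure.snd, lintegral_map hH.lintegral_prod_right' measurable_snd]
  simp only [socialCost]
  rw [lintegral_add_left h12, lintegral_add_left hc, lintegral_const_mul _ h3, h4, meanL_snd hL]

lemma mem_plans_of_eq_average {μ : ProbabilityMeasure 𝒳} {N : ℕ} (hN : 1 ≤ N)
    {κ : Fin N → Strategy 𝒳 𝒴} {η : ProbabilityMeasure (𝒳 × 𝒴)}
    (hη : (η : Measure (𝒳 × 𝒴)) = average fun i => (μ : Measure 𝒳) ⊗ₘ (κ i).1) :
    η ∈ plans 𝒴 μ := by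
  change (η : Measure (𝒳 × 𝒴)).map Prod.fst = μ
  rw [hη, map_average _ measurable_fst]
  have : ∀ i, ((μ : Measure 𝒳) ⊗ₘ (κ i).1).map Prod.fst = μ := fun i => Measure.fst_compProd _ _
  simp only [this, average_const hN]

lemma snd_of_eq_average {μ : Measure 𝒳} [IsProbabilityMeasure μ] {N : ℕ}
    (κ : Fin N → Strategy 𝒳 𝒴) :
    (average fun i => μ ⊗ₘ (κ i).1).snd = average fun i => (κ i).1 ∘ₘ μ := by
  rw [Measure.snd, map_average _ measurable_snd]
  congr 1
  ext1 i
  exact Measure.snd_compProd _ _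

end TotalCost

/-! ### Lower semicontinuity, compactness and the Γ-lower bound -/

section LowerSemicontinuity

lemma lowerSemicontinuous_const_mul {Z : Type*} [TopologicalSpace Z] {f : Z → ℝ≥0∞}
    (hf : LowerSemicontinuous f) {a : ℝ≥0∞} (ha : a ≠ ∞) :
    LowerSemicontinuous fun z => a * f z :=
  (ENNReal.continuous_const_mul ha).comp_lowerSemicontinuous hf fun _ _ h => mul_le_mul_right h _

lemma lowerSemicontinuous_socialCost {𝒳 𝒴 : Type*} [TopologicalSpace 𝒳] [TopologicalSpace 𝒴]
    [PolishSpace 𝒴] [MeasurableSpace 𝒴] [BorelSpace 𝒴] {c : 𝒳 × 𝒴 → ℝ≥0∞} {L : 𝒴 → ℝ≥0∞}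
    {H : 𝒴 × 𝒴 → ℝ≥0∞} [MeasurableSpace 𝒳] (hc : LowerSemicontinuous c) (hL : LowerSemicontinuous L)
    (hH : LowerSemicontinuous H) (ν : Measure 𝒴) :
    LowerSemicontinuous fun p : 𝒳 × 𝒴 => socialCost c L H p.1 p.2 ν :=
  (hc.add (hL.comp continuous_snd)).add (lowerSemicontinuous_const_mul
    ((lowerSemicontinuous_lintegral_prodMk hH ν).comp continuous_snd) (by simp))

variable {𝒳 𝒴 : Type*} [TopologicalSpace 𝒳] [PolishSpace 𝒳] [MeasurableSpace 𝒳] [BorelSpace 𝒳]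
  [TopologicalSpace 𝒴] [PolishSpace 𝒴] [MeasurableSpace 𝒴] [BorelSpace 𝒴]
  {c : 𝒳 × 𝒴 → ℝ≥0∞} {L : 𝒴 → ℝ≥0∞} {H : 𝒴 × 𝒴 → ℝ≥0∞}

/-- Passing to the limit in upper bounds of total costs. -/
lemma total_cost_le_of_tendsto (hc : LowerSemicontinuous c) (hL : LowerSemicontinuous L)
    (hH : LowerSemicontinuous H) {a : ℝ≥0∞} (ha : a ≠ ∞)
    {η : ℕ → ProbabilityMeasure (𝒳 × 𝒴)} {γ : ProbabilityMeasure (𝒳 × 𝒴)}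
    (hη : Tendsto η atTop (𝓝 γ)) {b : ℕ → ℝ≥0∞} {B : ℝ≥0∞} (hb : Tendsto b atTop (𝓝 B))
    (hle : ∀ k, ∫⁻ p, c p ∂(η k : Measure (𝒳 × 𝒴)) + meanL L (η k : Measure (𝒳 × 𝒴)).snd
      + a * interH H (η k : Measure (𝒳 × 𝒴)).snd (η k : Measure (𝒳 × 𝒴)).snd ≤ b k) :
    ∫⁻ p, c p ∂(γ : Measure (𝒳 × 𝒴)) + meanL L (γ : Measure (𝒳 × 𝒴)).snd
      + a * interH H (γ : Measure (𝒳 × 𝒴)).snd (γ : Measure (𝒳 × 𝒴)).snd ≤ B := by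
  -- The total cost is the integral of one lower semicontinuous function against `η k ⊗ η k`, which
  -- converges weakly to `γ ⊗ γ`.
  have hlsc : LowerSemicontinuous fun r : (𝒳 × 𝒴) × (𝒳 × 𝒴) =>
      c r.1 + L r.1.2 + a * H (r.1.2, r.2.2) := by
    refine LowerSemicontinuous.add (LowerSemicontinuous.add (hc.comp continuous_fst) ?_) ?_
    · exact hL.comp (g := fun r : (𝒳 × 𝒴) × (𝒳 × 𝒴) => r.1.2) (by fun_prop)
    · exact lowerSemicontinuous_const_mul
        (hH.comp (g := fun r : (𝒳 × 𝒴) × (𝒳 × 𝒴) => (r.1.2, r.2.2)) (by fun_prop)) ha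
  have hprod : Tendsto (fun k => (η k).prod (η k)) atTop (𝓝 (γ.prod γ)) :=
    (ProbabilityMeasure.continuous_prod.tendsto (γ, γ)).comp (hη.prodMk_nhds hη)
  have h1 := lintegral_le_liminf_of_lowerSemicontinuous hlsc hprod
  simp only [ProbabilityMeasure.toMeasure_prod] at h1
  simp only [lintegral_pair_cost hc.measurable hL.measurable hH.measurable] at h1
  refine h1.trans ?_
  rw [← hb.liminf_eq]
  exact liminf_le_liminf (Eventually.of_forall hle)

lemma mem_plans_of_tendsto {μ : ProbabilityMeasure 𝒳} {η : ℕ → ProbabilityMeasure (𝒳 × 𝒴)}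
    {γ : ProbabilityMeasure (𝒳 × 𝒴)} (hη : Tendsto η atTop (𝓝 γ)) (h : ∀ k, η k ∈ plans 𝒴 μ) :
    γ ∈ plans 𝒴 μ := by
  have h1 := ProbabilityMeasure.tendsto_map_of_tendsto_of_continuous η γ hη
    (continuous_fst (X := 𝒳) (Y := 𝒴))
  have h2 : ∀ k, (η k).map (continuous_fst (X := 𝒳) (Y := 𝒴)).measurable.aemeasurable = μ :=
    fun k => Subtype.ext (h k)
  simp only [h2] at h1
  exact congrArg ProbabilityMeasure.toMeasure (tendsto_nhds_unique h1 tendsto_const_nhds)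

/-- Plans with bounded mean individual energy are relatively compact. -/
lemma exists_tendsto_subseq (hL : Measurable L)
    (hL_compact : ∀ r : ℝ≥0, 0 < r → IsCompact {y | L y ≤ r}) {μ : ProbabilityMeasure 𝒳}
    {η : ℕ → ProbabilityMeasure (𝒳 × 𝒴)} (h : ∀ k, η k ∈ plans 𝒴 μ) {J : ℝ≥0∞} (hJ : J ≠ ∞)
    (hLJ : ∀ k, meanL L (η k : Measure (𝒳 × 𝒴)).snd ≤ J) :
    ∃ (γ : ProbabilityMeasure (𝒳 × 𝒴)) (ψ : ℕ → ℕ), StrictMono ψ ∧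
      Tendsto (fun k => η (ψ k)) atTop (𝓝 γ) := by
  have htight : IsTightMeasureSet
      {((ρ : ProbabilityMeasure (𝒳 × 𝒴)) : Measure (𝒳 × 𝒴)) | ρ ∈ Set.range η} := by
    -- Tightness is checked on marginals: the first is always `μ`, and the second is controlled by
    -- Markov's inequality on the compact sublevels of `L`.
    refine IsTightMeasureSet.prodMk ((isTightMeasureSet_singleton (μ := (μ : Measure 𝒳))).subset ?_)
      ?_
    · rintro _ ⟨_, ⟨_, ⟨k, rfl⟩, rfl⟩, rfl⟩
      exact h k
    · rw [isTightMeasureSet_iff_exists_isCompact_measure_compl_le]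
      intro ε hε
      set r : ℝ≥0 := (J / ε).toNNReal + 1
      have hJε : J / ε ≠ ∞ := ENNReal.div_ne_top hJ hε.ne'
      refine ⟨_, hL_compact r (by positivity), ?_⟩
      rintro _ ⟨_, ⟨_, ⟨k, rfl⟩, rfl⟩, rfl⟩
      rcases eq_or_ne ε ∞ with rfl | hεtop
      · exact le_top
      have hr : J / ε ≤ r := by
        simp only [r, ENNReal.coe_add, ENNReal.coe_toNNReal hJε]
        exact le_self_add
      have hr0 : (r : ℝ≥0∞) ≠ 0 := by simp [r]
      have hJr : J ≤ r * ε := (ENNReal.div_le_iff hε.ne' hεtop).1 hr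
      refine (ENNReal.mul_le_mul_iff_right hr0 ENNReal.coe_ne_top).1 (le_trans ?_ hJr)
      refine le_trans ?_ (hLJ k)
      refine le_trans ?_ (mul_meas_ge_le_lintegral hL (r : ℝ≥0∞))
      gcongr
      exact fun y (hy : ¬ L y ≤ r) => (not_le.1 hy).le
  have hcomp := isCompact_closure_of_isTightMeasureSet htight
  obtain ⟨γ, -, ψ, hψ, hlim⟩ := hcomp.tendsto_subseq (x := η)
    fun k => subset_closure (Set.mem_range_self k)
  exact ⟨γ, ψ, hψ, hlim⟩

/-- The lower bound of the Γ-convergence of the potentials to the energy. -/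
lemma energy_le_of_tendsto (hc : LowerSemicontinuous c) (hL : LowerSemicontinuous L)
    (hH : LowerSemicontinuous H) {μ : ProbabilityMeasure 𝒳} {N : ℕ → ℕ} (hN : ∀ k, 1 ≤ N k)
    (hNlim : Tendsto N atTop atTop) {κ : ∀ k, Fin (N k) → Strategy 𝒳 𝒴}
    {η : ℕ → ProbabilityMeasure (𝒳 × 𝒴)}
    (hη : ∀ k, (η k : Measure (𝒳 × 𝒴)) = average fun i => (μ : Measure 𝒳) ⊗ₘ (κ k i).1)
    {γ : ProbabilityMeasure (𝒳 × 𝒴)} (hlim : Tendsto η atTop (𝓝 γ)) {J : ℝ≥0∞}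
    (hJ : ∀ k, profilePotential c L H μ (κ k) ≤ J) : energy c L H μ γ ≤ J := by
  rw [energy_eq (mem_plans_of_tendsto hlim fun k => mem_plans_of_eq_average (hN k) (hη k))]
  -- The potential omits the terms `i = j`, which may be infinite in the interaction of the
  -- averages. With `H` truncated at `M` they add at most `M / N`; the supremum over `M` is taken
  -- after the limit in `k`.
  have hsup : interH H (γ : Measure (𝒳 × 𝒴)).snd (γ : Measure (𝒳 × 𝒴)).snd
      = ⨆ M : ℕ, interH (fun p => min (H p) M) (γ : Measure (𝒳 × 𝒴)).snd
        (γ : Measure (𝒳 × 𝒴)).snd := lintegral_eq_iSup_lintegral_min hH.measurable _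
  rw [hsup, ENNReal.add_iSup]
  refine iSup_le fun M => ?_
  have hHM : LowerSemicontinuous fun p => min (H p) (M : ℝ≥0∞) := hH.inf lowerSemicontinuous_const
  have hNinv : Tendsto (fun k => (N k : ℝ≥0∞)⁻¹) atTop (𝓝 0) :=
    ENNReal.tendsto_inv_nat_nhds_zero.comp hNlim
  have hb : Tendsto (fun k => J + (N k : ℝ≥0∞)⁻¹ * M) atTop (𝓝 J) := by
    have := tendsto_const_nhds (x := J).add
      (ENNReal.Tendsto.mul_const hNinv (Or.inr (ENNReal.natCast_ne_top M)))
    simpa using this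
  have := total_cost_le_of_tendsto hc hL hHM (a := 1) (by simp) hlim hb fun k => ?_
  · simpa using this
  refine le_trans ?_ (add_le_add_left (hJ k) _)
  rw [hη k, snd_of_eq_average, one_mul, lintegral_average, meanL, lintegral_average, ← mul_add,
    ← Finset.sum_add_distrib, profilePotential, add_assoc]
  gcongr
  · rfl
  have hpm : ∀ i, IsProbabilityMeasure ((κ k i).1 ∘ₘ (μ : Measure 𝒳)) := fun i => inferInstance
  have := isProbabilityMeasure_average (hN k) fun i => (κ k i).1 ∘ₘ (μ : Measure 𝒳)
  rw [interH_average_left hHM.measurable]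
  simp_rw [interH_average_right hHM.measurable (hN k)]
  have hdiag : ∀ i, interH (fun p => min (H p) (M : ℝ≥0∞)) ((κ k i).1 ∘ₘ (μ : Measure 𝒳))
      ((κ k i).1 ∘ₘ (μ : Measure 𝒳)) ≤ M := fun i => by
    refine (lintegral_mono (g := fun _ => (M : ℝ≥0∞)) fun p => min_le_right _ _).trans ?_
    simp
  have hoff : ∀ i j, interH (fun p => min (H p) (M : ℝ≥0∞)) ((κ k i).1 ∘ₘ (μ : Measure 𝒳))
      ((κ k j).1 ∘ₘ (μ : Measure 𝒳)) ≤ interH H ((κ k i).1 ∘ₘ (μ : Measure 𝒳))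
      ((κ k j).1 ∘ₘ (μ : Measure 𝒳)) := fun i j => lintegral_mono fun p => min_le_left _ _
  calc _ = ((N k : ℝ≥0∞) ^ 2)⁻¹ * ∑ i, ∑ j, interH (fun p => min (H p) (M : ℝ≥0∞))
        ((κ k i).1 ∘ₘ (μ : Measure 𝒳)) ((κ k j).1 ∘ₘ (μ : Measure 𝒳)) := by
        rw [← Finset.mul_sum, ← mul_assoc, ENNReal.inv_pow, sq]
    _ ≤ ((N k : ℝ≥0∞) ^ 2)⁻¹ * ∑ i, (M + ∑ j ∈ Finset.univ.erase i,
        interH H ((κ k i).1 ∘ₘ (μ : Measure 𝒳)) ((κ k j).1 ∘ₘ (μ : Measure 𝒳))) := by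
        gcongr with i
        rw [← Finset.add_sum_erase _ _ (Finset.mem_univ i)]
        gcongr with j
        · exact hdiag i
        · exact hoff i j
    _ = _ := by
        rw [Finset.sum_add_distrib, mul_add, add_comm, ENNReal.inv_pow, sq,
          mul_assoc (_⁻¹) (_⁻¹) (∑ i : Fin (N k), (M : ℝ≥0∞)), natCast_inv_mul_sum_const (hN k)]

end LowerSemicontinuity

/-! ### First-order optimality of minimizers of the energy -/

section FirstOrder

/-- The quadratic in `t` on the right equals the left side at `t = 0`, so its derivative there, `(A'
+ 2k) - (A + 2h)`, is nonnegative. -/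
lemma add_two_mul_le_of_forall_mixture {A A' h k h' : ℝ} (hh : 0 ≤ h) (hk : 0 ≤ k) (hh' : 0 ≤ h')
    (H : ∀ t : ℝ, 0 < t → t ≤ 1 → A + h ≤ (1 - t) * A + t * A'
      + ((1 - t) ^ 2 * h + 2 * ((1 - t) * t * k) + t ^ 2 * h')) : A + 2 * h ≤ A' + 2 * k := by
  by_contra! hcon
  set d := A + 2 * h - (A' + 2 * k) with hd
  have hdpos : 0 < d := by linarith
  have hpos : 0 < 2 * (h + h' + 1) := by linarith
  -- So small that the second-order term `t (h - 2k + h')` stays below the supposed gap `d`.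
  set t := min 1 (d / (2 * (h + h' + 1))) with ht
  have htpos : 0 < t := lt_min one_pos (div_pos hdpos hpos)
  have ht1 : t ≤ 1 := min_le_left _ _
  have ht2 : t * (2 * (h + h' + 1)) ≤ d := (le_div_iff₀ hpos).1 (min_le_right _ _)
  have h1 := H t htpos ht1
  have h2 : t * d ≤ t * (t * (h - 2 * k + h')) := by rw [hd]; nlinarith
  have h3 := le_of_mul_le_mul_left h2 htpos
  nlinarith [mul_nonneg htpos.le hk, mul_nonneg htpos.le hh, mul_nonneg htpos.le hh']

variable {𝒳 𝒴 : Type*} [MeasurableSpace 𝒳] [MeasurableSpace 𝒴]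
  {c : 𝒳 × 𝒴 → ℝ≥0∞} {L : 𝒴 → ℝ≥0∞} {H : 𝒴 × 𝒴 → ℝ≥0∞}

lemma interH_mixture (hH : Measurable H) (hsymm : ∀ y y', H (y, y') = H (y', y))
    (ν ν' : Measure 𝒴) [SFinite ν] [SFinite ν'] (s t : ℝ≥0∞) [SFinite (s • ν + t • ν')] :
    interH H (s • ν + t • ν') (s • ν + t • ν')
      = s ^ 2 * interH H ν ν + 2 * (s * t * interH H ν ν') + t ^ 2 * interH H ν' ν' := by
  have h1 : ∀ ρ : Measure 𝒴, [SFinite ρ] → Measurable fun y => ∫⁻ y', H (y, y') ∂ρ :=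
    fun ρ _ => hH.lintegral_prod_right'
  have h2 := interH_comm hH hsymm ν' ν
  simp only [interH_eq_lintegral hH, lintegral_add_measure, lintegral_smul_measure,
    smul_eq_mul] at h2 ⊢
  rw [lintegral_add_left ((h1 ν).const_mul s), lintegral_add_left ((h1 ν).const_mul s),
    lintegral_const_mul _ (h1 ν), lintegral_const_mul _ (h1 ν), lintegral_const_mul _ (h1 ν'),
    lintegral_const_mul _ (h1 ν'), h2]
  ring

/-- A minimizer of the energy minimizes its own social cost among plans of finite energy. -/
lemma lintegral_socialCost_le_of_minimizer (hc : Measurable c) (hL : Measurable L)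
    (hH : Measurable H) (hsymm : ∀ y y', H (y, y') = H (y', y)) {μ : ProbabilityMeasure 𝒳}
    {γ γ' : ProbabilityMeasure (𝒳 × 𝒴)} (hγ : γ ∈ plans 𝒴 μ) (hγ' : γ' ∈ plans 𝒴 μ)
    (hmin : ∀ ρ ∈ plans 𝒴 μ, energy c L H μ γ ≤ energy c L H μ ρ)
    (hfin : energy c L H μ γ ≠ ∞)
    (hA' : ∫⁻ p, c p ∂(γ' : Measure (𝒳 × 𝒴)) + meanL L (γ' : Measure (𝒳 × 𝒴)).snd ≠ ∞)
    (hk : interH H (γ : Measure (𝒳 × 𝒴)).snd (γ' : Measure (𝒳 × 𝒴)).snd ≠ ∞)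
    (hh' : interH H (γ' : Measure (𝒳 × 𝒴)).snd (γ' : Measure (𝒳 × 𝒴)).snd ≠ ∞) :
    ∫⁻ p, socialCost c L H p.1 p.2 (γ : Measure (𝒳 × 𝒴)).snd ∂(γ : Measure (𝒳 × 𝒴))
      ≤ ∫⁻ p, socialCost c L H p.1 p.2 (γ : Measure (𝒳 × 𝒴)).snd ∂(γ' : Measure (𝒳 × 𝒴)) := by
  rw [lintegral_socialCost hc hL hH, lintegral_socialCost hc hL hH,
    interH_comm hH hsymm (γ' : Measure (𝒳 × 𝒴)).snd]
  -- Minimality against `s γ + t γ'`, with the energy expanded by bilinearity.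
  have hmix : ∀ s t : ℝ≥0, s + t = 1 →
      (∫⁻ p, c p ∂(γ : Measure (𝒳 × 𝒴)) + meanL L (γ : Measure (𝒳 × 𝒴)).snd)
        + interH H (γ : Measure (𝒳 × 𝒴)).snd (γ : Measure (𝒳 × 𝒴)).snd
      ≤ s * (∫⁻ p, c p ∂(γ : Measure (𝒳 × 𝒴)) + meanL L (γ : Measure (𝒳 × 𝒴)).snd)
        + t * (∫⁻ p, c p ∂(γ' : Measure (𝒳 × 𝒴)) + meanL L (γ' : Measure (𝒳 × 𝒴)).snd)
        + (s ^ 2 * interH H (γ : Measure (𝒳 × 𝒴)).snd (γ : Measure (𝒳 × 𝒴)).snd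
          + 2 * (s * t * interH H (γ : Measure (𝒳 × 𝒴)).snd (γ' : Measure (𝒳 × 𝒴)).snd)
          + t ^ 2 * interH H (γ' : Measure (𝒳 × 𝒴)).snd (γ' : Measure (𝒳 × 𝒴)).snd) := by
    intro s t hst
    have hst' : (s : ℝ≥0∞) + t = 1 := by exact_mod_cast congrArg ((↑) : ℝ≥0 → ℝ≥0∞) hst
    let ρ : ProbabilityMeasure (𝒳 × 𝒴) :=
      ⟨(s : ℝ≥0∞) • (γ : Measure (𝒳 × 𝒴)) + (t : ℝ≥0∞) • (γ' : Measure (𝒳 × 𝒴)),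
        ⟨by simp [hst']⟩⟩
    have hρcoe : (ρ : Measure (𝒳 × 𝒴))
      = (s : ℝ≥0∞) • (γ : Measure (𝒳 × 𝒴)) + (t : ℝ≥0∞) • (γ' : Measure (𝒳 × 𝒴)) := rfl
    have hρ : ρ ∈ plans 𝒴 μ := by
      change (ρ : Measure (𝒳 × 𝒴)).map Prod.fst = μ
      have h1 : (γ : Measure (𝒳 × 𝒴)).map Prod.fst = μ := hγ
      have h2 : (γ' : Measure (𝒳 × 𝒴)).map Prod.fst = μ := hγ'
      rw [hρcoe, Measure.map_add _ _ measurable_fst, Measure.map_smul, Measure.map_smul, h1, h2,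
        ← add_smul, hst', one_smul]
    have hsnd : (ρ : Measure (𝒳 × 𝒴)).snd = (s : ℝ≥0∞) • (γ : Measure (𝒳 × 𝒴)).snd
        + (t : ℝ≥0∞) • (γ' : Measure (𝒳 × 𝒴)).snd := by
      rw [hρcoe, Measure.snd, Measure.map_add _ _ measurable_snd, Measure.map_smul,
        Measure.map_smul]
      rfl
    have hsf : SFinite ((s : ℝ≥0∞) • (γ : Measure (𝒳 × 𝒴)).snd
        + (t : ℝ≥0∞) • (γ' : Measure (𝒳 × 𝒴)).snd) := hsnd ▸ inferInstance
    have h := hmin ρ hρ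
    rw [energy_eq hγ, energy_eq hρ, hsnd, interH_mixture hH hsymm, hρcoe, lintegral_add_measure,
      lintegral_smul_measure, lintegral_smul_measure, meanL, meanL, lintegral_add_measure,
      lintegral_smul_measure, lintegral_smul_measure] at h
    refine h.trans_eq ?_
    simp only [smul_eq_mul, meanL]
    ring
  rw [energy_eq hγ] at hfin
  have hA := (ENNReal.add_ne_top.1 hfin).1
  have hh := (ENNReal.add_ne_top.1 hfin).2
  revert hmix hA hh hA' hk hh'
  -- All five quantities are finite, so the inequality becomes one between real numbers.
  generalize ∫⁻ p, c p ∂(γ : Measure (𝒳 × 𝒴)) + meanL L (γ : Measure (𝒳 × 𝒴)).snd = A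
  generalize ∫⁻ p, c p ∂(γ' : Measure (𝒳 × 𝒴)) + meanL L (γ' : Measure (𝒳 × 𝒴)).snd = A'
  generalize interH H (γ : Measure (𝒳 × 𝒴)).snd (γ : Measure (𝒳 × 𝒴)).snd = h
  generalize interH H (γ : Measure (𝒳 × 𝒴)).snd (γ' : Measure (𝒳 × 𝒴)).snd = k
  generalize interH H (γ' : Measure (𝒳 × 𝒴)).snd (γ' : Measure (𝒳 × 𝒴)).snd = h'
  intro hA' hk hh' hmix hA hh
  lift A to ℝ≥0 using hA
  lift A' to ℝ≥0 using hA'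
  lift h to ℝ≥0 using hh
  lift k to ℝ≥0 using hk
  lift h' to ℝ≥0 using hh'
  have := add_two_mul_le_of_forall_mixture (A := A) (A' := A') h.2 k.2 h'.2 fun t ht ht1 => by
    lift t to ℝ≥0 using ht.le
    have ht1' : t ≤ 1 := by exact_mod_cast ht1
    have h1 := hmix (1 - t) t (tsub_add_cancel_of_le ht1')
    have h2 : A + h ≤ (1 - t) * A + t * A'
        + ((1 - t) ^ 2 * h + 2 * ((1 - t) * t * k) + t ^ 2 * h') := by exact_mod_cast h1
    have h3 := NNReal.coe_le_coe.2 h2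
    push_cast [NNReal.coe_sub ht1'] at h3
    exact h3
  exact_mod_cast this

end FirstOrder

/-! ### Characterization of equilibria -/

section Equilibrium

lemma exists_measurable_best_response {𝒳 𝒴 : Type*} [TopologicalSpace 𝒳] [MeasurableSpace 𝒳]
    [OpensMeasurableSpace 𝒳] [TopologicalSpace 𝒴] [PolishSpace 𝒴] [MeasurableSpace 𝒴]
    [BorelSpace 𝒴] {c : 𝒳 × 𝒴 → ℝ≥0∞} {L : 𝒴 → ℝ≥0∞} {H : 𝒴 × 𝒴 → ℝ≥0∞}
    (hc : LowerSemicontinuous c) (hL : LowerSemicontinuous L)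
    (hH : LowerSemicontinuous H) (hL_compact : ∀ r : ℝ≥0, 0 < r → IsCompact {y | L y ≤ r})
    (ν : ProbabilityMeasure 𝒴) :
    ∃ T : 𝒳 → 𝒴, Measurable T ∧
      ∀ x y, socialCost c L H x (T x) ν ≤ socialCost c L H x y ν := by
  have := ν.nonempty
  exact exists_measurable_argmin (lowerSemicontinuous_socialCost hc hL hH (ν : Measure 𝒴))
    hL_compact fun x y => le_add_right le_add_self

/-- The best response is cheaper pointwise and, by `hle`, no cheaper on average. As its mean cost is
finite, the two costs agree almost everywhere. -/
lemma isCournotNash_of_lintegral_le {𝒳 𝒴 : Type*} [MeasurableSpace 𝒳] [MeasurableSpace 𝒴]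
    {c : 𝒳 × 𝒴 → ℝ≥0∞} {L : 𝒴 → ℝ≥0∞} {H : 𝒴 × 𝒴 → ℝ≥0∞}
    (hc : Measurable c) (hL : Measurable L) (hH : Measurable H)
    {μ : ProbabilityMeasure 𝒳} {γ : ProbabilityMeasure (𝒳 × 𝒴)} (hγ : γ ∈ plans 𝒴 μ)
    {T : 𝒳 → 𝒴} (hT : Measurable T)
    (hTmin : ∀ x y, socialCost c L H x (T x) (γ : Measure (𝒳 × 𝒴)).snd
      ≤ socialCost c L H x y (γ : Measure (𝒳 × 𝒴)).snd)
    (hfin : ∫⁻ x, socialCost c L H x (T x) (γ : Measure (𝒳 × 𝒴)).snd ∂(μ : Measure 𝒳) ≠ ∞)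
    (hle : ∫⁻ p, socialCost c L H p.1 p.2 (γ : Measure (𝒳 × 𝒴)).snd ∂(γ : Measure (𝒳 × 𝒴))
      ≤ ∫⁻ x, socialCost c L H x (T x) (γ : Measure (𝒳 × 𝒴)).snd ∂(μ : Measure 𝒳)) :
    IsCournotNash (socialCost c L H) μ γ := by
  refine ⟨hγ, ?_⟩
  have hm := measurable_socialCost hc hL hH (γ : Measure (𝒳 × 𝒴)).snd
  have hmT : Measurable fun x => socialCost c L H x (T x) (γ : Measure (𝒳 × 𝒴)).snd :=
    hm.comp (measurable_id.prodMk hT)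
  have hμ : (γ : Measure (𝒳 × 𝒴)).map Prod.fst = μ := hγ
  rw [← hμ, lintegral_map hmT measurable_fst] at hfin hle
  have hae := ae_eq_of_ae_le_of_lintegral_le
    (Eventually.of_forall fun p : 𝒳 × 𝒴 => hTmin p.1 p.2) hfin hm.aemeasurable hle
  filter_upwards [hae] with p hp y'
  exact hp.symm.le.trans (hTmin p.1 y')

variable {𝒳 𝒴 : Type*} [TopologicalSpace 𝒳] [PolishSpace 𝒳] [MeasurableSpace 𝒳] [BorelSpace 𝒳]
  [TopologicalSpace 𝒴] [PolishSpace 𝒴] [MeasurableSpace 𝒴] [BorelSpace 𝒴]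
  {c : 𝒳 × 𝒴 → ℝ≥0∞} {L : 𝒴 → ℝ≥0∞} {H : 𝒴 × 𝒴 → ℝ≥0∞}

/-- Under the approximation condition, minimizers of the energy are Cournot–Nash equilibria. -/
theorem isCournotNash_of_minimizer (hc : LowerSemicontinuous c) (hL : LowerSemicontinuous L)
    (hH : LowerSemicontinuous H) (hsymm : ∀ y y', H (y, y') = H (y', y))
    (hL_compact : ∀ r : ℝ≥0, 0 < r → IsCompact {y | L y ≤ r})
    (happrox : ApproximationCondition c L H) {μ : ProbabilityMeasure 𝒳}
    {γ : ProbabilityMeasure (𝒳 × 𝒴)} (hγ : γ ∈ plans 𝒴 μ)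
    (hmin : ∀ ρ ∈ plans 𝒴 μ, energy c L H μ γ ≤ energy c L H μ ρ)
    (hfin : energy c L H μ γ ≠ ∞) : IsCournotNash (socialCost c L H) μ γ := by
  obtain ⟨C, κ, -, hA⟩ := happrox
  let ν : ProbabilityMeasure 𝒴 := ⟨(γ : Measure (𝒳 × 𝒴)).snd, inferInstance⟩
  obtain ⟨T, hT, hTmin⟩ := exists_measurable_best_response hc hL hH hL_compact ν
  obtain ⟨κ₀, hκ₀⟩ := exists_strategy_of_mem_plans hγ
  have hcm := hc.measurable
  have hLm := hL.measurable
  have hHm := hH.measurable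
  set Φ : 𝒳 → 𝒴 → ℝ≥0∞ := fun x y => socialCost c L H x y ν
  have hΦ : Measurable fun p : 𝒳 × 𝒴 => Φ p.1 p.2 := measurable_socialCost hcm hLm hHm _
  set m : 𝒳 → ℝ≥0∞ := fun x => Φ x (T x)
  have hm : Measurable m := hΦ.comp (measurable_id.prodMk hT)
  have hμ : (γ : Measure (𝒳 × 𝒴)).map Prod.fst = μ := hγ
  set φ₀ : 𝒳 → ℝ≥0∞ := fun x => ∫⁻ y, Φ x y ∂(κ₀.1 x)
  have hφ₀ : Measurable φ₀ := measurable_lintegral_section hΦ κ₀.1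
  have hφ₀_int : ∫⁻ p, Φ p.1 p.2 ∂(γ : Measure (𝒳 × 𝒴)) = ∫⁻ x, φ₀ x ∂(μ : Measure 𝒳) := by
    rw [hκ₀, Measure.lintegral_compProd hΦ]
  rw [energy_eq hγ] at hfin
  have hh := (ENNReal.add_ne_top.1 hfin).2
  have hΦfin : ∫⁻ p, Φ p.1 p.2 ∂(γ : Measure (𝒳 × 𝒴)) ≠ ∞ := by
    refine (lintegral_socialCost hcm hLm hHm _ _).trans_ne ?_
    exact ENNReal.add_ne_top.2 ⟨(ENNReal.add_ne_top.1 hfin).1, ENNReal.mul_ne_top (by simp) hh⟩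
  have hm_le : ∫⁻ x, m x ∂(μ : Measure 𝒳) ≤ ∫⁻ x, φ₀ x ∂(μ : Measure 𝒳) := by
    refine lintegral_mono fun x => ?_
    calc m x = ∫⁻ _, m x ∂(κ₀.1 x) := by simp
      _ ≤ φ₀ x := lintegral_mono fun y => hTmin x y
  have hφ₀fin : ∫⁻ x, φ₀ x ∂(μ : Measure 𝒳) ≠ ∞ := hφ₀_int ▸ hΦfin
  have hmfin : ∫⁻ x, m x ∂(μ : Measure 𝒳) ≠ ∞ := (hm_le.trans_lt hφ₀fin.lt_top).ne
  refine isCournotNash_of_lintegral_le hcm hLm hHm hγ hT hTmin hmfin ?_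
  change ∫⁻ p, Φ p.1 p.2 ∂(γ : Measure (𝒳 × 𝒴)) ≤ ∫⁻ x, m x ∂(μ : Measure 𝒳)
  rw [hφ₀_int]
  refine ENNReal.le_of_forall_pos_le_add fun δ hδ _ => ?_
  set ψ : ℕ → 𝒳 → ℝ≥0∞ := fun n x => ∫⁻ z, Φ x z ∂((κ n).1 (T x))
  have hψ : ∀ n, Measurable (ψ n) := fun n =>
    measurable_lintegral_section hΦ ((κ n).1.comap T hT)
  -- The types for which the spread-out best response `(κ n).1 (T x)` is within `δ` of optimal. By
  -- condition (A) each `x` with `m x < ∞` eventually belongs to `E n`.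
  set E : ℕ → Set 𝒳 := fun n => {x | m x < ∞ ∧ ψ n x ≤ m x + δ}
  have hE : ∀ n, MeasurableSet (E n) := fun n =>
    (measurableSet_lt hm measurable_const).inter (measurableSet_le (hψ n) (hm.add_const _))
  have hEev : ∀ x, m x < ∞ → ∀ᶠ n in atTop, x ∈ E n := by
    intro x hx
    have h1 := (hA x (T x) (T x) ν hx).2
    have h2 : m x < m x + δ := ENNReal.lt_add_right hx.ne (by exact_mod_cast hδ.ne')
    filter_upwards [h1.eventually (gt_mem_nhds h2)] with n hn
    exact ⟨hx, hn.le⟩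
  have hstep : ∀ n, ∫⁻ x in E n, φ₀ x ∂(μ : Measure 𝒳) ≤ ∫⁻ x, m x ∂(μ : Measure 𝒳) + δ := by
    intro n
    classical
    -- The competitor changes `γ` only on `E n`, so the costs off `E n` cancel in the optimality
    -- inequality.
    let κ' : Strategy 𝒳 𝒴 := ⟨Kernel.piecewise (hE n) ((κ n).1.comap T hT) κ₀.1, inferInstance⟩
    have hκ'E : ∀ x ∈ E n, κ'.1 x = (κ n).1 (T x) := fun x hx => by
      simp [κ', Kernel.piecewise_apply, hx]
    have hκ'E' : ∀ x ∉ E n, κ'.1 x = κ₀.1 x := fun x hx => by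
      simp [κ', Kernel.piecewise_apply, hx]
    let γ' : ProbabilityMeasure (𝒳 × 𝒴) := ⟨(μ : Measure 𝒳) ⊗ₘ κ'.1, inferInstance⟩
    have hγ'coe : (γ' : Measure (𝒳 × 𝒴)) = (μ : Measure 𝒳) ⊗ₘ κ'.1 := rfl
    have hγ' : γ' ∈ plans 𝒴 μ := Measure.fst_compProd _ _
    have hcost : ∫⁻ p, Φ p.1 p.2 ∂(γ' : Measure (𝒳 × 𝒴)) = ∫⁻ x in E n, ψ n x ∂(μ : Measure 𝒳)
        + ∫⁻ x in (E n)ᶜ, φ₀ x ∂(μ : Measure 𝒳) := by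
      rw [hγ'coe, Measure.lintegral_compProd hΦ, ← lintegral_add_compl _ (hE n)]
      congr 1
      · exact setLIntegral_congr_fun (hE n) fun x hx => by simp only [hκ'E x hx, ψ]
      · exact setLIntegral_congr_fun (hE n).compl fun x hx => by simp only [hκ'E' x hx, φ₀]
    have hψE : ∫⁻ x in E n, ψ n x ∂(μ : Measure 𝒳) ≤ ∫⁻ x, m x ∂(μ : Measure 𝒳) + δ := by
      calc ∫⁻ x in E n, ψ n x ∂(μ : Measure 𝒳) ≤ ∫⁻ x in E n, (m x + δ) ∂(μ : Measure 𝒳) :=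
            setLIntegral_mono' (hE n) fun x hx => hx.2
        _ ≤ ∫⁻ x, (m x + δ) ∂(μ : Measure 𝒳) := setLIntegral_le_lintegral _ _
        _ = _ := by rw [lintegral_add_right _ measurable_const]; simp
    have hφE : ∫⁻ x in (E n)ᶜ, φ₀ x ∂(μ : Measure 𝒳) ≠ ∞ :=
      ((setLIntegral_le_lintegral _ _).trans_lt hφ₀fin.lt_top).ne
    have hcostfin : ∫⁻ p, Φ p.1 p.2 ∂(γ' : Measure (𝒳 × 𝒴)) ≠ ∞ := by
      rw [hcost]
      exact ENNReal.add_ne_top.2 ⟨(hψE.trans_lt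
        (ENNReal.add_lt_top.2 ⟨hmfin.lt_top, ENNReal.coe_lt_top⟩)).ne, hφE⟩
    have hcostfin' := hcostfin
    rw [show ∫⁻ p, Φ p.1 p.2 ∂(γ' : Measure (𝒳 × 𝒴)) = _ from
      lintegral_socialCost hcm hLm hHm _ _] at hcostfin'
    -- The cross interaction is part of the finite cost of `γ'` under `Φ`.
    have hk : interH H (γ : Measure (𝒳 × 𝒴)).snd (γ' : Measure (𝒳 × 𝒴)).snd ≠ ∞ := by
      rw [interH_comm hHm hsymm]
      intro htop
      refine (ENNReal.add_ne_top.1 hcostfin').2 ?_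
      change 2 * interH H (γ' : Measure (𝒳 × 𝒴)).snd (γ : Measure (𝒳 × 𝒴)).snd = ∞
      rw [htop]
      exact ENNReal.mul_top (by simp)
    have hsnd' : (γ' : Measure (𝒳 × 𝒴)).snd = κ'.1 ∘ₘ (μ : Measure 𝒳) := Measure.snd_compProd _ _
    have hsnd : (γ : Measure (𝒳 × 𝒴)).snd = κ₀.1 ∘ₘ (μ : Measure 𝒳) := by
      rw [hκ₀]; exact Measure.snd_compProd _ _
    have hLm_le : ∀ x, L (T x) ≤ m x := fun x => le_add_right le_add_self
    have hh' : interH H (γ' : Measure (𝒳 × 𝒴)).snd (γ' : Measure (𝒳 × 𝒴)).snd ≠ ∞ := by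
      -- Pairs in `E n × E n` are bounded by condition (A) and `L (T x) ≤ m x`; any other pair has
      -- an unmodified strategy `κ₀` and is bounded by a cross interaction.
      have hpt : ∀ p : 𝒳 × 𝒳, interH H (κ'.1 p.1) (κ'.1 p.2)
          ≤ (C n * (1 + m p.1 + m p.2) + interH H (κ'.1 p.1) (κ₀.1 p.2))
            + (interH H (κ₀.1 p.1) (κ'.1 p.2) + interH H (κ₀.1 p.1) (κ₀.1 p.2)) := by
        intro p
        by_cases h1 : p.1 ∈ E n
        · by_cases h2 : p.2 ∈ E n
          · rw [hκ'E _ h1, hκ'E _ h2]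
            refine ((hA p.1 (T p.1) (T p.2) ν h1.1).1 n).trans ?_
            refine le_add_right (le_add_right ?_)
            gcongr
            · exact hLm_le _
            · exact hLm_le _
          · rw [hκ'E' _ h2]
            exact le_add_right le_add_self
        · rw [hκ'E' _ h1]
          exact le_add_left le_self_add
      have hbd : ∫⁻ p, C n * (1 + m p.1 + m p.2) ∂((μ : Measure 𝒳).prod (μ : Measure 𝒳)) ≠ ∞ := by
        have hm1 : Measurable fun p : 𝒳 × 𝒳 => m p.1 := hm.comp measurable_fst
        have hm2 : Measurable fun p : 𝒳 × 𝒳 => m p.2 := hm.comp measurable_snd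
        have hm12 : Measurable fun p : 𝒳 × 𝒳 => 1 + m p.1 := hm1.const_add 1
        have hm' : Measurable fun p : 𝒳 × 𝒳 => 1 + m p.1 + m p.2 := hm12.add hm2
        rw [lintegral_const_mul _ hm', lintegral_add_left hm12,
          lintegral_add_left measurable_const, lintegral_prod _ hm1.aemeasurable,
          lintegral_prod _ hm2.aemeasurable]
        simp only [lintegral_const, measure_univ, mul_one]
        exact ENNReal.mul_ne_top ENNReal.coe_ne_top
          (ENNReal.add_ne_top.2 ⟨ENNReal.add_ne_top.2 ⟨by simp, hmfin⟩, hmfin⟩)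
      have hI : ∀ κ₁ κ₂ : Strategy 𝒳 𝒴, Measurable fun p : 𝒳 × 𝒳 =>
          interH H (κ₁.1 p.1) (κ₂.1 p.2) := fun κ₁ κ₂ => measurable_interH hHm κ₁.1 κ₂.1
      rw [hsnd', interH_comp hHm]
      refine ((lintegral_mono hpt).trans_lt ?_).ne
      have hI' : Measurable fun p : 𝒳 × 𝒳 =>
          interH H (κ₀.1 p.1) (κ'.1 p.2) + interH H (κ₀.1 p.1) (κ₀.1 p.2) :=
        (hI κ₀ κ').add (hI κ₀ κ₀)
      rw [lintegral_add_right _ hI', lintegral_add_right _ (hI κ' κ₀),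
        lintegral_add_right _ (hI κ₀ κ₀), ← interH_comp hHm, ← interH_comp hHm, ← interH_comp hHm,
        ← hsnd, ← hsnd', interH_comm hHm hsymm (γ' : Measure (𝒳 × 𝒴)).snd]
      simp only [ENNReal.add_lt_top]
      exact ⟨⟨hbd.lt_top, hk.lt_top⟩, hk.lt_top, hh.lt_top⟩
    have hopt := lintegral_socialCost_le_of_minimizer hcm hLm hHm hsymm hγ hγ' hmin
      (by rw [energy_eq hγ]; exact hfin) (ENNReal.add_ne_top.1 hcostfin').1 hk hh'
    change ∫⁻ p, Φ p.1 p.2 ∂(γ : Measure (𝒳 × 𝒴)) ≤ ∫⁻ p, Φ p.1 p.2 ∂(γ' : Measure (𝒳 × 𝒴)) at hopt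
    rw [hφ₀_int, hcost, ← lintegral_add_compl _ (hE n)] at hopt
    exact ((ENNReal.add_le_add_iff_right hφE).1 hopt).trans hψE
  -- The sets `E n` eventually contain almost every type, and `φ₀` dominates.
  have hlim : Tendsto (fun n => ∫⁻ x in (E n)ᶜ, φ₀ x ∂(μ : Measure 𝒳)) atTop (𝓝 0) := by
    have h1 : Tendsto (fun n => ∫⁻ x, (E n)ᶜ.indicator φ₀ x ∂(μ : Measure 𝒳)) atTop
        (𝓝 (∫⁻ _, 0 ∂(μ : Measure 𝒳))) := by
      refine tendsto_lintegral_of_dominated_convergence φ₀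
        (fun n => hφ₀.indicator (hE n).compl)
        (fun n => Eventually.of_forall fun x => Set.indicator_le_self _ _ x) hφ₀fin ?_
      filter_upwards [ae_lt_top hm hmfin] with x hx
      refine tendsto_const_nhds.congr' ?_
      filter_upwards [hEev x hx] with n hn
      simp [hn]
    simpa [lintegral_indicator (hE _).compl] using h1
  have hlim' := hlim.const_add (∫⁻ x, m x ∂(μ : Measure 𝒳) + δ)
  rw [add_zero] at hlim'
  refine ge_of_tendsto' hlim' fun n => ?_
  rw [← lintegral_add_compl _ (hE n)]
  gcongr
  exact hstep n

end Equilibrium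

/-! ### Limits of open-loop Nash equilibria -/

section NashLimit

/-- Approximate optimality of the average of a Nash equilibrium, when `H` is bounded. -/
lemma total_cost_le_of_isOpenLoopNash {𝒳 𝒴 Ω : Type*} [MeasurableSpace 𝒳] [MeasurableSpace 𝒴]
    [MeasurableSpace Ω] {P : Measure Ω} [IsProbabilityMeasure P]
    {μ : Measure 𝒳} [IsProbabilityMeasure μ] {X : ℕ → Ω → 𝒳}
    (hX_meas : ∀ i, Measurable (X i)) (hX_indep : iIndepFun X P)
    (hX_law : ∀ i, P.map (X i) = μ) {c : 𝒳 × 𝒴 → ℝ≥0∞} {L : 𝒴 → ℝ≥0∞} {H : 𝒴 × 𝒴 → ℝ≥0∞}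
    (hc : Measurable c) (hL : Measurable L) (hH : Measurable H) {M : ℝ≥0} (hM : ∀ p, H p ≤ M)
    {N : ℕ} (hN : 1 ≤ N) {κ : Fin N → Strategy 𝒳 𝒴} (hκ : IsOpenLoopNash c L H P X κ)
    {η : Measure (𝒳 × 𝒴)} (hη : η = average fun i => μ ⊗ₘ (κ i).1) (κ' : Strategy 𝒳 𝒴) :
    ∫⁻ p, c p ∂η + meanL L η.snd + 2 * interH H η.snd η.snd
      ≤ ∫⁻ p, c p ∂(μ ⊗ₘ κ'.1) + meanL L (κ'.1 ∘ₘ μ) + 2 * interH H (κ'.1 ∘ₘ μ) η.snd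
        + 2 * (N : ℝ≥0∞)⁻¹ * M := by
  set m : Fin N → Measure 𝒴 := fun i => (κ i).1 ∘ₘ μ with hm
  have hpm : ∀ i, IsProbabilityMeasure (m i) := fun i => inferInstance
  have hpa := isProbabilityMeasure_average hN m
  have hsnd : η.snd = average m := by rw [hη, snd_of_eq_average]
  have hplayer : ∀ i, ∫⁻ p, c p ∂(μ ⊗ₘ (κ i).1) + meanL L (m i) + 2 * interH H (m i) (average m)
      ≤ ∫⁻ p, c p ∂(μ ⊗ₘ κ'.1) + meanL L (κ'.1 ∘ₘ μ) + 2 * interH H (κ'.1 ∘ₘ μ) (average m)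
        + 2 * (N : ℝ≥0∞)⁻¹ * M := by
    intro i
    have hnash := hκ i κ'
    rw [playerCost_eq hX_meas hX_indep hX_law hc hL hH,
      playerCost_eq hX_meas hX_indep hX_law hc hL hH, Function.update_self] at hnash
    -- On the deviation side, the interaction with the discarded strategy of player `i` can be added
    -- freely; on the equilibrium side, the missing self-interaction costs at most `2M/N`.
    have hsum : ∑ j ∈ Finset.univ.erase i, interH H (κ'.1 ∘ₘ μ)
        ((Function.update κ i κ' j).1 ∘ₘ μ) ≤ ∑ j, interH H (κ'.1 ∘ₘ μ) (m j) := by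
      refine le_trans (Finset.sum_le_sum fun j hj => ?_)
        (Finset.sum_le_sum_of_subset (Finset.erase_subset i Finset.univ))
      rw [Function.update_of_ne (Finset.ne_of_mem_erase hj)]
    have hself : interH H (m i) (m i) ≤ M := by
      refine (lintegral_mono (g := fun _ => (M : ℝ≥0∞)) hM).trans ?_
      simp
    rw [interH_average_right hH hN, interH_average_right hH hN, ← mul_assoc 2, ← mul_assoc 2,
      ← Finset.add_sum_erase _ _ (Finset.mem_univ i)]
    calc _ = ∫⁻ p, c p ∂(μ ⊗ₘ (κ i).1) + meanL L (m i) + 2 / (N : ℝ≥0∞) *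
          ∑ j ∈ Finset.univ.erase i, interH H (m i) (m j)
          + 2 * (N : ℝ≥0∞)⁻¹ * interH H (m i) (m i) := by
          rw [div_eq_mul_inv]; ring
      _ ≤ _ := by
          refine add_le_add (hnash.trans ?_) (mul_le_mul_right hself _)
          rw [div_eq_mul_inv]
          gcongr
  -- All players are tested against the same deviation, so averaging leaves the right side
  -- unchanged.
  have h1 := mul_le_mul_right (Finset.sum_le_sum fun i (_ : i ∈ Finset.univ) => hplayer i)
    (N : ℝ≥0∞)⁻¹
  rw [natCast_inv_mul_sum_const hN] at h1
  rw [hsnd]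
  refine le_trans (le_of_eq ?_) h1
  rw [interH_average_left hH, hη, lintegral_average, meanL, lintegral_average,
    Finset.sum_add_distrib, Finset.sum_add_distrib, ← Finset.mul_sum]
  simp only [meanL]
  ring

variable {𝒳 𝒴 Ω : Type*} [TopologicalSpace 𝒳] [PolishSpace 𝒳] [MeasurableSpace 𝒳] [BorelSpace 𝒳]
  [TopologicalSpace 𝒴] [PolishSpace 𝒴] [MeasurableSpace 𝒴] [BorelSpace 𝒴]
  [MeasurableSpace Ω] {P : Measure Ω} [IsProbabilityMeasure P]
  {X : ℕ → Ω → 𝒳} {c : 𝒳 × 𝒴 → ℝ≥0∞} {L : 𝒴 → ℝ≥0∞} {H : 𝒴 × 𝒴 → ℝ≥0∞}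

/-- The products `ρ ⊗ ν k` converge weakly, and `H` is a bounded continuous test function once
viewed with values in `ℝ≥0`. -/
lemma tendsto_interH (hH : Continuous H) {M : ℝ≥0} (hM : ∀ p, H p ≤ M) (ρ : ProbabilityMeasure 𝒴)
    {ν : ℕ → ProbabilityMeasure 𝒴} {ν₀ : ProbabilityMeasure 𝒴} (hν : Tendsto ν atTop (𝓝 ν₀)) :
    Tendsto (fun k => interH H (ρ : Measure 𝒴) (ν k : Measure 𝒴)) atTop
      (𝓝 (interH H (ρ : Measure 𝒴) (ν₀ : Measure 𝒴))) := by
  have hfin : ∀ p, H p ≠ ∞ := fun p => ((hM p).trans_lt ENNReal.coe_lt_top).ne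
  let f : 𝒴 × 𝒴 →ᵇ ℝ≥0 := BoundedContinuousFunction.mkOfBound
    ⟨fun p => (H p).toNNReal, ENNReal.continuousOn_toNNReal.comp_continuous hH hfin⟩ M
    fun p q => by
      have hb : ∀ p, ((H p).toNNReal : ℝ) ≤ M := fun p =>
        NNReal.coe_le_coe.2 (ENNReal.toNNReal_mono ENNReal.coe_ne_top (hM p))
      rw [NNReal.dist_eq, abs_le]
      constructor
      · have := hb q
        have h0 : (0 : ℝ) ≤ (H p).toNNReal := NNReal.coe_nonneg _
        change -(M : ℝ) ≤ ((H p).toNNReal : ℝ) - (H q).toNNReal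
        linarith
      · have := hb p
        have h0 : (0 : ℝ) ≤ (H q).toNNReal := NNReal.coe_nonneg _
        change ((H p).toNNReal : ℝ) - (H q).toNNReal ≤ M
        linarith
  have hprod : Tendsto (fun k => ρ.prod (ν k)) atTop (𝓝 (ρ.prod ν₀)) :=
    (ProbabilityMeasure.continuous_prod.tendsto (ρ, ν₀)).comp (tendsto_const_nhds.prodMk_nhds hν)
  have h := ProbabilityMeasure.tendsto_iff_forall_lintegral_tendsto.1 hprod f
  have hf : ∀ p, (f p : ℝ≥0∞) = H p := fun p => ENNReal.coe_toNNReal (hfin p)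
  simp only [hf, ProbabilityMeasure.toMeasure_prod] at h
  exact h

/-- For continuous and bounded `H`, weak limits of the averages of Nash equilibria are
Cournot–Nash equilibria. -/
theorem isCournotNash_of_isOpenLoopNash {μ : ProbabilityMeasure 𝒳}
    (hX_meas : ∀ i, Measurable (X i)) (hX_indep : iIndepFun X P)
    (hX_law : ∀ i, P.map (X i) = (μ : Measure 𝒳))
    (hc : LowerSemicontinuous c) (hL : LowerSemicontinuous L)
    (hL_compact : ∀ r : ℝ≥0, 0 < r → IsCompact {y | L y ≤ r})
    (h_inf : ∃ γ ∈ plans 𝒴 μ, energy c L H μ γ < ∞)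
    (hH : Continuous H) {M : ℝ≥0} (hM : ∀ p, H p ≤ M)
    {N : ℕ → ℕ} (hN : ∀ k, 1 ≤ N k) (hNlim : Tendsto N atTop atTop)
    {κ : ∀ k, Fin (N k) → Strategy 𝒳 𝒴} (hκ : ∀ k, IsOpenLoopNash c L H P X (κ k))
    {η : ℕ → ProbabilityMeasure (𝒳 × 𝒴)}
    (hη : ∀ k, (η k : Measure (𝒳 × 𝒴)) = average fun i => (μ : Measure 𝒳) ⊗ₘ (κ k i).1)
    {γ : ProbabilityMeasure (𝒳 × 𝒴)} (hlim : Tendsto η atTop (𝓝 γ)) :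
    IsCournotNash (socialCost c L H) μ γ := by
  have hγ : γ ∈ plans 𝒴 μ :=
    mem_plans_of_tendsto hlim fun k => mem_plans_of_eq_average (hN k) (hη k)
  have hcm := hc.measurable
  have hLm := hL.measurable
  have hHm := hH.measurable
  let snd : ProbabilityMeasure (𝒳 × 𝒴) → ProbabilityMeasure 𝒴 := fun ρ =>
    ρ.map measurable_snd.aemeasurable
  have hsnd_coe : ∀ ρ, (snd ρ : Measure 𝒴) = (ρ : Measure (𝒳 × 𝒴)).snd := fun ρ => rfl
  have hsnd : Tendsto (fun k => snd (η k)) atTop (𝓝 (snd γ)) :=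
    ProbabilityMeasure.tendsto_map_of_tendsto_of_continuous η γ hlim continuous_snd
  have hNinv : Tendsto (fun k => (N k : ℝ≥0∞)⁻¹) atTop (𝓝 0) :=
    ENNReal.tendsto_inv_nat_nhds_zero.comp hNlim
  have hopt : ∀ κ' : Strategy 𝒳 𝒴,
      ∫⁻ p, socialCost c L H p.1 p.2 (γ : Measure (𝒳 × 𝒴)).snd ∂(γ : Measure (𝒳 × 𝒴))
      ≤ ∫⁻ p, socialCost c L H p.1 p.2 (γ : Measure (𝒳 × 𝒴)).snd
        ∂((μ : Measure 𝒳) ⊗ₘ κ'.1) := by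
    intro κ'
    rw [lintegral_socialCost hcm hLm hHm, lintegral_socialCost hcm hLm hHm, Measure.snd_compProd]
    refine total_cost_le_of_tendsto hc hL hH.lowerSemicontinuous (by simp) hlim ?_ fun k =>
      total_cost_le_of_isOpenLoopNash hX_meas hX_indep hX_law hcm hLm hHm hM (hN k) (hκ k) (hη k) κ'
    let ρ : ProbabilityMeasure 𝒴 := ⟨κ'.1 ∘ₘ (μ : Measure 𝒳), inferInstance⟩
    have h1 := tendsto_interH hH hM ρ hsnd
    have h2 := (ENNReal.Tendsto.const_mul (a := 2) h1 (Or.inr (by simp))).const_add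
      (∫⁻ p, c p ∂((μ : Measure 𝒳) ⊗ₘ κ'.1) + meanL L (κ'.1 ∘ₘ (μ : Measure 𝒳)))
    have h3 : Tendsto (fun k => 2 * (N k : ℝ≥0∞)⁻¹ * M) atTop (𝓝 0) := by
      have := ENNReal.Tendsto.mul_const (b := (M : ℝ≥0∞))
        (ENNReal.Tendsto.const_mul (a := 2) hNinv (Or.inr (by simp))) (Or.inr ENNReal.coe_ne_top)
      simpa using this
    have h4 := h2.add h3
    rw [add_zero] at h4
    exact h4
  obtain ⟨T, hT, hTmin⟩ := exists_measurable_best_response hc hL hH.lowerSemicontinuous hL_compact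
    (snd γ)
  simp only [hsnd_coe] at hTmin
  have hΦ : Measurable fun p : 𝒳 × 𝒴 => socialCost c L H p.1 p.2 (γ : Measure (𝒳 × 𝒴)).snd :=
    measurable_socialCost hcm hLm hHm _
  have hΦT : Measurable fun x => socialCost c L H x (T x) (γ : Measure (𝒳 × 𝒴)).snd :=
    hΦ.comp (measurable_id.prodMk hT)
  refine isCournotNash_of_lintegral_le hcm hLm hHm hγ hT hTmin ?_ ?_
  -- A plan of finite energy has finite `c` and `L` costs, and `H ≤ M` bounds its interaction with
  -- the marginal of `γ`; the best response costs no more.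
  · obtain ⟨γ', hγ', hfin⟩ := h_inf
    have hμ : (γ' : Measure (𝒳 × 𝒴)).map Prod.fst = μ := hγ'
    rw [← hμ, lintegral_map hΦT measurable_fst]
    refine ((lintegral_mono (fun p : 𝒳 × 𝒴 => hTmin p.1 p.2)).trans_lt ?_).ne
    rw [lintegral_socialCost hcm hLm hHm]
    rw [energy_eq hγ'] at hfin
    refine ENNReal.add_lt_top.2 ⟨(ENNReal.add_lt_top.1 hfin).1, ENNReal.mul_lt_top (by simp) ?_⟩
    refine (lintegral_mono (g := fun _ => (M : ℝ≥0∞)) hM).trans_lt ?_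
    simp
  -- With `H` bounded, the pure best response is itself an admissible comparison, without condition
  -- (A).
  · refine (hopt ⟨Kernel.deterministic T hT, inferInstance⟩).trans_eq ?_
    rw [Measure.lintegral_compProd hΦ]
    refine lintegral_congr fun x => ?_
    rw [Kernel.deterministic_apply]
    exact lintegral_dirac' _ (hΦ.comp measurable_prodMk_left)

end NashLimit

/-! ### Limits of minimizers of the potentials -/

section MinimizerLimit

lemma exists_average_plan {𝒳 𝒴 : Type*} [MeasurableSpace 𝒳] [MeasurableSpace 𝒴]
    {μ : ProbabilityMeasure 𝒳} {N : ℕ} (hN : 1 ≤ N) (κ : Fin N → Strategy 𝒳 𝒴) :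
    ∃ η : ProbabilityMeasure (𝒳 × 𝒴),
      (η : Measure (𝒳 × 𝒴)) = average fun i => (μ : Measure 𝒳) ⊗ₘ (κ i).1 :=
  ⟨⟨_, isProbabilityMeasure_average hN _⟩, rfl⟩

variable {𝒳 𝒴 Ω : Type*} [TopologicalSpace 𝒳] [PolishSpace 𝒳] [MeasurableSpace 𝒳] [BorelSpace 𝒳]
  [TopologicalSpace 𝒴] [PolishSpace 𝒴] [MeasurableSpace 𝒴] [BorelSpace 𝒴]
  [MeasurableSpace Ω] {P : Measure Ω} [IsProbabilityMeasure P] {μ : ProbabilityMeasure 𝒳}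
  {X : ℕ → Ω → 𝒳} {c : 𝒳 × 𝒴 → ℝ≥0∞} {L : 𝒴 → ℝ≥0∞} {H : 𝒴 × 𝒴 → ℝ≥0∞}

/-- The upper bound of the Γ-convergence, valid for every `N ≥ 1`: let all players use the
disintegration of `ρ`. -/
lemma openLoopPotential_le_energy (hμ : ∀ x, (μ : Measure 𝒳) {x} = 0)
    (hX_meas : ∀ i, Measurable (X i)) (hX_indep : iIndepFun X P)
    (hX_law : ∀ i, P.map (X i) = (μ : Measure 𝒳))
    (hc : Measurable c) (hL : Measurable L) (hH : Measurable H) {N : ℕ} (hN : 1 ≤ N)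
    {γ : RandomPM Ω (𝒳 × 𝒴)} (hmin : IsMinOn (openLoopPotential c L H P X N) Set.univ γ)
    {ρ : ProbabilityMeasure (𝒳 × 𝒴)} (hρ : ρ ∈ plans 𝒴 μ) :
    openLoopPotential c L H P X N γ ≤ energy c L H μ ρ := by
  obtain ⟨κ, hκ⟩ := exists_strategy_of_mem_plans hρ
  obtain ⟨γ', hγ'⟩ := exists_isInducedBy (P := P) hX_meas hN fun _ : Fin N => κ
  have hle : openLoopPotential c L H P X N γ ≤ openLoopPotential c L H P X N γ' :=
    hmin (Set.mem_univ γ')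
  refine hle.trans ?_
  rw [openLoopPotential_eq hμ hX_meas hX_indep hX_law hc hL hH hN hγ']
  exact profilePotential_const_le c L H hN hρ hκ

/-- Minimizers of the potentials converge narrowly, along a subsequence, to a deterministic
minimizer of the energy. -/
theorem exists_narrowTendsto_minimizer (hμ : ∀ x, (μ : Measure 𝒳) {x} = 0)
    (hX_meas : ∀ i, Measurable (X i)) (hX_indep : iIndepFun X P)
    (hX_law : ∀ i, P.map (X i) = (μ : Measure 𝒳))
    (hc : LowerSemicontinuous c) (hL : LowerSemicontinuous L) (hH : LowerSemicontinuous H)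
    (hL_compact : ∀ r : ℝ≥0, 0 < r → IsCompact {y | L y ≤ r})
    (h_inf : ∃ γ ∈ plans 𝒴 μ, energy c L H μ γ < ∞)
    {γ : ℕ → RandomPM Ω (𝒳 × 𝒴)}
    (hmin : ∀ N, 1 ≤ N → IsMinOn (openLoopPotential c L H P X N) Set.univ (γ N))
    (hind : ∀ N, 1 ≤ N → ∃ κ : Fin N → Strategy 𝒳 𝒴, IsInducedBy P X κ (γ N)) :
    ∃ (φ : ℕ → ℕ) (γ₀ : ProbabilityMeasure (𝒳 × 𝒴)), StrictMono φ ∧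
      NarrowTendsto P (fun k => γ (φ k)) (RandomPM.const Ω γ₀) ∧ γ₀ ∈ plans 𝒴 μ ∧
      ∀ ρ ∈ plans 𝒴 μ, energy c L H μ γ₀ ≤ energy c L H μ ρ := by
  have hcm := hc.measurable
  have hLm := hL.measurable
  have hHm := hH.measurable
  -- Index `k` stands for `k + 1` players, which excludes `N = 0`.
  choose κ hκ using fun k : ℕ => hind (k + 1) (Nat.le_add_left 1 k)
  choose η hη using fun k : ℕ =>
    exists_average_plan (μ := μ) (Nat.le_add_left 1 k) (κ k)
  have hplans : ∀ k, η k ∈ plans 𝒴 μ := fun k =>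
    mem_plans_of_eq_average (Nat.le_add_left 1 k) (hη k)
  have hpot : ∀ ρ ∈ plans 𝒴 μ, ∀ k, profilePotential c L H μ (κ k) ≤ energy c L H μ ρ := by
    intro ρ hρ k
    rw [← openLoopPotential_eq hμ hX_meas hX_indep hX_law hcm hLm hHm (Nat.le_add_left 1 k) (hκ k)]
    exact openLoopPotential_le_energy hμ hX_meas hX_indep hX_law hcm hLm hHm
      (Nat.le_add_left 1 k) (hmin _ (Nat.le_add_left 1 k)) hρ
  obtain ⟨ρ₀, hρ₀, hfin⟩ := h_inf
  have hLJ : ∀ k, meanL L (η k : Measure (𝒳 × 𝒴)).snd ≤ energy c L H μ ρ₀ := by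
    intro k
    refine le_trans ?_ (hpot ρ₀ hρ₀ k)
    rw [hη k, snd_of_eq_average, meanL, lintegral_average, profilePotential]
    refine le_add_right ?_
    gcongr
    exact le_add_self
  obtain ⟨γ₀, ψ, hψ, hlim⟩ := exists_tendsto_subseq hLm hL_compact hplans hfin.ne hLJ
  -- Thinning along squares gives at least `(k + 1)²` players at step `k`, so the inverse numbers of
  -- players are summable.
  have hsq : StrictMono fun k : ℕ => (k + 1) ^ 2 := fun a b hab =>
    Nat.pow_lt_pow_left (Nat.add_lt_add_right hab 1) two_ne_zero
  have hθ : StrictMono fun k : ℕ => ψ ((k + 1) ^ 2) := hψ.comp hsq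
  refine ⟨fun k => ψ ((k + 1) ^ 2) + 1, γ₀, fun a b hab => Nat.add_lt_add_right (hθ hab) 1, ?_,
    mem_plans_of_tendsto hlim fun k => hplans _, fun ρ hρ => ?_⟩
  · refine narrowTendsto_of_ae_tendsto ?_
    refine ae_tendsto_of_summable (N := fun k => ψ ((k + 1) ^ 2) + 1) hX_meas hX_indep hX_law
      (fun k => Nat.le_add_left 1 _) ?_ (fun k => hκ _) (fun k => hη _)
      (hlim.comp hsq.tendsto_atTop)
    have hs : Summable fun k : ℕ => (((k + 1 : ℕ) : ℝ) ^ 2)⁻¹ :=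
      (summable_nat_add_iff 1).2 (Real.summable_nat_pow_inv.2 one_lt_two)
    refine Summable.of_nonneg_of_le (fun k => by positivity) (fun k => ?_) hs
    gcongr
    have : (k + 1) ^ 2 ≤ ψ ((k + 1) ^ 2) + 1 := (hψ.id_le _).trans (Nat.le_succ _)
    exact_mod_cast this
  · exact energy_le_of_tendsto hc hL hH (N := fun k => ψ k + 1) (fun k => Nat.le_add_left 1 _)
      (tendsto_atTop_mono (fun k => Nat.le_succ _) hψ.tendsto_atTop) (fun k => hη (ψ k)) hlim
      fun k => hpot ρ hρ _

end MinimizerLimit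

end CournotNash

end

/-! ### The main theorem -/

open CournotNash in
theorem theorem4p5
    {𝒳 𝒴 Ω : Type*}
    [TopologicalSpace 𝒳] [PolishSpace 𝒳] [MeasurableSpace 𝒳] [BorelSpace 𝒳]
    [TopologicalSpace 𝒴] [PolishSpace 𝒴] [MeasurableSpace 𝒴] [BorelSpace 𝒴]
    [MeasurableSpace Ω] (P : Measure Ω) [IsProbabilityMeasure P]
    -- the distribution of types, and an i.i.d. sample of it
    (μ : ProbabilityMeasure 𝒳) (hμ : ∀ x, (μ : Measure 𝒳) {x} = 0)
    (X : ℕ → Ω → 𝒳) (hX_meas : ∀ i, Measurable (X i)) (hX_indep : iIndepFun X P)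
    (hX_law : ∀ i, P.map (X i) = (μ : Measure 𝒳))
    -- the costs
    (c : 𝒳 × 𝒴 → ℝ≥0∞) (L : 𝒴 → ℝ≥0∞) (H : 𝒴 × 𝒴 → ℝ≥0∞)
    (hc : LowerSemicontinuous c) (hL : LowerSemicontinuous L) (hH : LowerSemicontinuous H)
    (hH_symm : ∀ y y', H (y, y') = H (y', y))
    (hL_compact : ∀ r : ℝ≥0, 0 < r → IsCompact {y | L y ≤ r})
    (h_inf : (⨅ γ ∈ plans 𝒴 μ, energy c L H μ γ) < ∞) :
    -- minimizers of the potentials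
    (∀ γ : ℕ → RandomPM Ω (𝒳 × 𝒴),
      (∀ N, 1 ≤ N → IsMinOn (openLoopPotential c L H P X N) Set.univ (γ N)) →
        -- are induced by open-loop Nash equilibria only
        (∀ N, 1 ≤ N → (∃ κ : Fin N → Strategy 𝒳 𝒴, IsInducedBy P X κ (γ N)) ∧
          ∀ κ : Fin N → Strategy 𝒳 𝒴, IsInducedBy P X κ (γ N) → IsOpenLoopNash c L H P X κ) ∧
        -- and converge along a subsequence to a deterministic Cournot–Nash equilibrium
        ∃ (φ : ℕ → ℕ) (γ₀ : ProbabilityMeasure (𝒳 × 𝒴)),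
          StrictMono φ ∧
          NarrowTendsto P (fun k => γ (φ k)) (RandomPM.const Ω γ₀) ∧
          γ₀ ∈ plans 𝒴 μ ∧
          (ApproximationCondition c L H → IsCournotNash (socialCost c L H) μ γ₀)) ∧
    -- narrow limits of arbitrary open-loop Nash equilibria, for continuous and bounded `H`
    (Continuous H → (∃ M : ℝ≥0, ∀ p, H p ≤ M) →
      ∀ (κ : ∀ N : ℕ, Fin N → Strategy 𝒳 𝒴) (γ : ℕ → RandomPM Ω (𝒳 × 𝒴))
        (γlim : RandomPM Ω (𝒳 × 𝒴)),
        (∀ N, 1 ≤ N → IsOpenLoopNash c L H P X (κ N) ∧ IsInducedBy P X (κ N) (γ N)) →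
        NarrowTendsto P γ γlim →
        ∃ γ₀ : ProbabilityMeasure (𝒳 × 𝒴),
          (∀ᵐ ω ∂P, γlim.1 ω = γ₀) ∧
          γ₀ ∈ plans 𝒴 μ ∧
          IsCournotNash (socialCost c L H) μ γ₀) := by
  have hcm := hc.measurable
  have hLm := hL.measurable
  have hHm := hH.measurable
  have h_inf' : ∃ γ ∈ plans 𝒴 μ, energy c L H μ γ < ∞ := by
    simpa only [iInf_lt_iff, exists_prop] using h_inf
  refine ⟨fun γ hmin => ?_, fun hHc ⟨M, hM⟩ κ γ γlim hnash hlim => ?_⟩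
  · obtain ⟨ρ₀, hρ₀, hfin⟩ := h_inf'
    have hpot : ∀ N, 1 ≤ N → openLoopPotential c L H P X N (γ N) < ∞ := fun N hN =>
      (openLoopPotential_le_energy hμ hX_meas hX_indep hX_law hcm hLm hHm hN (hmin N hN)
        hρ₀).trans_lt hfin
    -- An infimum over no profile would be `∞`, so finite potential yields an inducing profile.
    have hind : ∀ N, 1 ≤ N → ∃ κ : Fin N → Strategy 𝒳 𝒴, IsInducedBy P X κ (γ N) := by
      intro N hN
      have h := hpot N hN
      simp only [openLoopPotential, iInf_lt_iff] at h
      obtain ⟨κ, hκ, -⟩ := h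
      exact ⟨κ, hκ⟩
    refine ⟨fun N hN => ⟨hind N hN, fun κ hκ => isOpenLoopNash_of_isMinOn hμ hX_meas hX_indep
      hX_law hcm hLm hHm hH_symm hN (hmin N hN) (hpot N hN) hκ⟩, ?_⟩
    obtain ⟨φ, γ₀, hφ, hlim, hγ₀, hγ₀min⟩ := exists_narrowTendsto_minimizer hμ hX_meas hX_indep
      hX_law hc hL hH hL_compact ⟨ρ₀, hρ₀, hfin⟩ hmin hind
    exact ⟨φ, γ₀, hφ, hlim, hγ₀, fun happrox => isCournotNash_of_minimizer hc hL hH hH_symm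
      hL_compact happrox hγ₀ hγ₀min ((hγ₀min ρ₀ hρ₀).trans_lt hfin).ne⟩
  · have hN : ∀ k : ℕ, 1 ≤ k + 1 := fun k => Nat.le_add_left 1 k
    have hNlim : Tendsto (fun k : ℕ => k + 1) atTop atTop := tendsto_add_atTop_nat 1
    choose η hη using fun k : ℕ => exists_average_plan (μ := μ) (hN k) (κ (k + 1))
    have hlim' : NarrowTendsto P (fun k => γ (k + 1)) γlim := hlim.comp hNlim
    obtain ⟨γ₀, hae, hηlim⟩ := exists_const_limit hX_meas hX_indep hX_law hN hNlim
      (fun k => (hnash (k + 1) (hN k)).2) hη hlim'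
    have hCN := isCournotNash_of_isOpenLoopNash hX_meas hX_indep hX_law hc hL hL_compact h_inf' hHc
      hM hN hNlim (fun k => (hnash (k + 1) (hN k)).1) hη hηlim
    exact ⟨γ₀, hae, hCN.1, hCN⟩
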